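/- **Model.** There are $p=2^m$ threads with ids $0,\dots,p-1$; every task requires $r\in\{1,2,4,\dots,2^m\}$ threads. The team of size $r=2^k$ containing thread $x$ is the block $B(x,r)=\{qr,\dots,(q+1)r-1\}\ni x$. Each thread has one deque per size $2^j$, $0\le j\le m$, a coordinator reference $c$, and a registration structure: the required number $r_x$, the set $A_x$ of acquired (registered) threads, and the current team size $t_x$; in addition the set of team members that have not yet started its last published task. A thread $i$ *follows* $w$ if $c_i=w$ and $i\in A_w$ (a thread with $c_i=w\ne i$, $i\notin A_w$ finds its registration revoked and resets $c_i=i$). When its queues change, a thread with $c_x=x$ sets $r_x=\max(t_x,\text{least requirement in its queues})$ and, if $r_x$ decreases, resets $A_x$ to $B(x,t_x)$. In an execution, arbitrary tasks are in the queues initially, every thread is its own coordinator with $t_x=1$ and $A_x=\{x\}$, and the threads perform atomic steps in an arbitrary interleaving: * A thread executing a task computes, spawns a task into its own queue, or finishes. * A thread $i$ with $c_i=i$ that executes nothing first waits until all its team members have started its last task. At the head of its loop ($\ell=0$) it then settles its team: it goes on with tasks of size $t_i$ if it has any, otherwise with its smallest tasks, for which the team is shrunk if they are smaller than $t_i$,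 and disbanded ($t_i=1$, $A_i=\{i\}$) if $t_i>1$ and they are larger; with empty queues the team is dissolved. If it has tasks and $|A_i|=r_i$, it launches one for the team $A_i$ and sets $t_i=r_i$. Otherwise, with tasks, it *polls* with coordinator $c=i$; without tasks, it looks at its partners $x=i\oplus2^\ell$, $\ell=0,\dots,m-1$, one per step: if $r_{c_x}\ge2^{\ell+1}$ and $i\in B(c_x,r_{c_x})$ it registers with $c_x$, otherwise it tries to steal from $x$. * A thread $i$ following $c\neq i$ that executes nothing starts the task published by $c$ if it has not done so; else it just waits if $i\in B(c,t_c)$, and *polls* otherwise. * *Polling* of $i$ with coordinator $c$: for $\ell=0,1,\dots$ with $2^\ell<r_c$, one per step, inspect $x=i\oplus 2^\ell$ and $w=c_x$. If $w=c$, or $(r_c,c)<(r_w,w)$ lexicographically, go on to $\ell+1$. Otherwise, if $r_w=r_c$ or $r_w\ge2^{\ell+1}$, then $i$ switches to $w$ provided that $i\in B(w,r_w)$: it stops coordinating, or drops its registration with $c$, and registers with $w$. Otherwise it tries to steal from $x$. After a switching or a stealing attempt, and after the last level, it starts again at $\ell=0$. * A *steal* of $i$ from its partner $x$ at level $\ell$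 transfers $\min(\lfloor n/2\rfloor,2^\ell)$ tasks from the top of one deque of $x$, of length $n$, for a size $2^j\le 2^\ell$; a thread that has obtained tasks is its own coordinator afterwards. If there is nothing to steal (for a polling thread: all these deques of $x$ are empty; for a thread without tasks: all these numbers are $0$), then $i$ goes on to $\ell+1$. Thread $x$ *coordinates* if $c_x=x$, it executes nothing, all members of its team have started its last task, and it has a task. Distinct threads $x,y$ are in *conflict* if both coordinate, $y\in B(x,r_x)$ and $x\in B(y,r_y)$. Thread $x$ *beats* $y$ if $r_x<r_y$, or $r_x=r_y$ and $x<y$. **Lemma (all conflicts are resolved deterministically).** In every execution: 1. If a coordinating thread $y$ obtains tasks of requirement $r'$ in a step (by stealing), then $r'<r_y$; it goes on coordinating, with new requirement $r'$. 2. Whenever $x$ and $y$ are in conflict, exactly one of them beats the other. Say $x$ beats $y$. If a thread $i$ that follows $y$ and is required by $x$, i.e. $i\in B(x,r_x)$, and that is free to switch (i.e. $i=y$, or $i$ executes nothing and $i\notin B(y,t_y)$) performs a step in which its current partner $i\oplus2^\ell$ follows $x$, then $i$ follows $x$ afterwards. If a thread $i$ that follows $x$ performs a step in which its current partner follows $y$,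 then $i$ still follows $x$ afterwards. 3. Suppose that every thread performs infinitely many steps and that the computation is finite, i.e. only finitely many steps are spent on executing tasks. Then every conflict between threads $x$ and $y$ persists only up to some later time, and the step that ends it is of one of the following two kinds, for $\{u,v\}=\{x,y\}$, while $v$ goes on coordinating with unchanged requirement: $u$ stops coordinating and registers with a coordinator $w$ that beats $u$ and whose team contains $u$; or $u$ goes on coordinating with a strictly smaller requirement $r'_u$ such that $v\notin B(u,r'_u)$. -/

import Mathlib

namespace TeamBuilding

/-- Thread ids `0, …, p - 1` for `p = 2 ^ m` hardware threads. -/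
abbrev Thread (m : ℕ) : Type := Fin (2 ^ m)

/-- Exponents `k` of the admissible thread requirements and team sizes `2 ^ k ≤ 2 ^ m`. -/
abbrev Level (m : ℕ) : Type := Fin (m + 1)

/-- The data of one thread.

* `queue j` is the deque of the tasks that require `2 ^ j` threads; the head of the list is the
  bottom of the deque, the last element is its top.
* `coord` is the reference `c` to the coordinator (a self-reference for a thread that is not
  registered with another one).
* `req`, `acq`, `team` form the registration structure `R`: the number of required threads is
  `r = 2 ^ req`, the set of acquired (registered) threads is `acq`, so that `a = acq.card`, and
  the number of teamed threads is `t = 2 ^ team`. A thread `z` with `coord = w` can tell whether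
  its registration is still active: this is the case iff `z` belongs to the set `acq` of `w`.
* `ready` is the task last published for the team, and `pend` the set of the threads that still
  have to start it, so that the countdown is `G = pend.card`.
* `run` is the task that the thread is executing, if any.
* `lev` is the current value of the loop variable `ℓ` in the polling or stealing loop. -/
structure Local (m : ℕ) (τ : Type*) where
  queue : Level m → List τ
  coord : Thread m
  req : Level m
  acq : Finset (Thread m)
  team : Level m
  ready : Option τ
  pend : Finset (Thread m)
  run : Option τ
  lev : ℕ

/-- A state of the scheduler. -/
abbrev State (m : ℕ) (τ : Type*) : Type _ := Thread m → Local m τ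

variable {m : ℕ} {τ : Type*}

/-- Partner of thread `i` at level `ℓ < m`: flip the `ℓ`-th bit of the id
(the reduction modulo `2 ^ m` is void for `ℓ < m`). -/
def partner (i : Thread m) (ℓ : ℕ) : Thread m :=
  ⟨((i : ℕ) ^^^ 2 ^ ℓ) % 2 ^ m, Nat.mod_lt _ (Nat.two_pow_pos m)⟩

/-- `overlap(x, y, 2 ^ k)`: both threads lie in the same block
`{q 2 ^ k, …, (q + 1) 2 ^ k - 1}`, i.e. in the same team of size `2 ^ k`. -/
def SameTeam (x y : Thread m) (k : Level m) : Prop :=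
  (x : ℕ) / 2 ^ (k : ℕ) = (y : ℕ) / 2 ^ (k : ℕ)

instance (x y : Thread m) (k : Level m) : Decidable (SameTeam x y k) :=
  inferInstanceAs (Decidable (_ = _))

/-- The team of size `2 ^ k` to which thread `x` belongs. -/
def block (x : Thread m) (k : Level m) : Finset (Thread m) :=
  Finset.univ.filter fun y => SameTeam x y k

/-- Some local queue is nonempty. -/
def HasTask (L : Local m τ) : Prop := ∃ j, L.queue j ≠ []

/-- The least level of a nonempty queue (`d` if all queues are empty). -/
def smallest (d : Level m) (q : Level m → List τ) : Level m :=
  (Finset.univ.filter fun j => (q j).length ≠ 0).min.untopD d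

/-- Update of the registration structure of `i` after its queues have changed:
`r ← max (t, least requirement in the queues)`, and if `r` decreases, then the acquired threads
are reset to the team. -/
def refresh (i : Thread m) (L : Local m τ) : Local m τ :=
  let r := max L.team (smallest L.team L.queue)
  { L with req := r, acq := if r < L.req then block i L.team else L.acq }

open Classical in
/-- What a coordinator does with its team before it turns to the next task: it keeps working on
the queue for the current team size; if that queue is empty it takes the smallest tasks, and the
team is shrunk for a smaller task and disbanded for a larger one; without tasks the team is
dissolved. -/
noncomputable def settle (i : Thread m) (L : Local m τ) : Local m τ :=
  if HasTask L then
    let k := if L.queue L.team ≠ [] then L.team else smallest L.team L.queue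
    if k ≤ L.team then { L with team := k, req := k, acq := block i k }
    else if 0 < L.team ∨ k < L.req then { L with team := 0, req := k, acq := {i} }
    else { L with req := k }
  else { L with team := 0, req := 0, acq := {i} }

/-- Replace the data of thread `i`. -/
def put (s : State m τ) (i : Thread m) (L : Local m τ) : State m τ := Function.update s i L

/-- Set the loop variable of thread `i`. -/
def setLev (i : Thread m) (ℓ : ℕ) (s : State m τ) : State m τ :=
  put s i { s i with lev := ℓ }

/-- Thread `i` stops coordinating, or drops its registration with its coordinator. -/
def leave (i : Thread m) (s : State m τ) : State m τ :=
  if (s i).coord = i then put s i { s i with req := 0, team := 0, acq := {i} }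
  else put s (s i).coord { s (s i).coord with acq := (s (s i).coord).acq.erase i }

/-- Thread `i` registers with the coordinator `w`. -/
def register (i w : Thread m) (s : State m τ) : State m τ :=
  let s₁ := put s w { s w with acq := insert i (s w).acq }
  put s₁ i { s₁ i with coord := w, lev := 0 }

/-- `switchToCoordinator(w)`, executed by thread `i`. -/
def switchTo (i w : Thread m) (s : State m τ) : State m τ :=
  if SameTeam w i (s w).req then register i w (leave i s) else setLev i 0 s

/-- Thread `i` becomes its own coordinator and, if it was actively registered with another
thread, deregisters there. -/
def detach (i : Thread m) (s : State m τ) : State m τ :=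
  if (s i).coord = i then s
  else
    let s₁ := leave i s
    put s₁ i { s₁ i with coord := i }

/-- The number of tasks of size `2 ^ j` that are stolen from a partner `x` at level `ℓ`. -/
def amount (x : Thread m) (j : Level m) (ℓ : ℕ) (s : State m τ) : ℕ :=
  min (((s x).queue j).length / 2) (2 ^ ℓ)

/-- Thread `i` transfers tasks of size `2 ^ j` from the top of the deque of its partner `x` at
level `ℓ` to the bottom of its own one. A thread that has obtained a task in this way coordinates
it itself. -/
def steal (i x : Thread m) (j : Level m) (ℓ : ℕ) (s : State m τ) : State m τ :=
  if amount x j ℓ s = 0 then setLev i 0 s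
  else
    let n := ((s x).queue j).length - amount x j ℓ s
    let loot := ((s x).queue j).drop n
    let s₁ := detach i s
    let s₂ := put s₁ x
      { s₁ x with queue := Function.update (s₁ x).queue j (((s₁ x).queue j).take n) }
    put s₂ i (refresh i
      { s₂ i with
        queue := Function.update (s₂ i).queue j (loot ++ (s₂ i).queue j)
        lev := 0 })

/-- The coordinator `i`, whose team is complete, starts the task `t` at the bottom of the
queue for the current requirement; `rest` is what remains in this queue. -/
def launch (i : Thread m) (t : τ) (rest : List τ) (s : State m τ) : State m τ :=
  put s i (refresh i
    { s i with
      team := (s i).req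
      queue := Function.update (s i).queue (s i).req rest
      ready := some t
      run := some t
      pend := (s i).acq.erase i
      lev := 0 })

/-- One iteration of the loop of `pollPartners(c, c.R.r)`, executed by thread `i` with coordinator
`c`: the partner at the current level `ℓ` is inspected. -/
inductive Poll (i : Thread m) (s : State m τ) : State m τ → Prop
  /-- All partners have been inspected. -/
  | done (h : ((s (s i).coord).req : ℕ) ≤ (s i).lev) : Poll i s (setLev i 0 s)
  /-- The partner has the same coordinator, or its coordinator loses. -/
  | skip (c x w : Thread m) (ℓ : ℕ) (hc : c = (s i).coord) (hℓ : ℓ = (s i).lev)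
      (hx : x = partner i ℓ) (hw : w = (s x).coord) (hlt : ℓ < ((s c).req : ℕ))
      (h : w = c ∨ (s c).req < (s w).req ∨ ((s w).req = (s c).req ∧ c < w)) :
      Poll i s (setLev i (ℓ + 1) s)
  /-- The partner's coordinator wins and its team is large enough to need this thread. -/
  | switch (c x w : Thread m) (ℓ : ℕ) (hc : c = (s i).coord) (hℓ : ℓ = (s i).lev)
      (hx : x = partner i ℓ) (hw : w = (s x).coord) (hlt : ℓ < ((s c).req : ℕ)) (hne : w ≠ c)
      (h : ((s w).req = (s c).req ∧ w < c) ∨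
        ((s w).req < (s c).req ∧ ℓ < ((s w).req : ℕ))) :
      Poll i s (switchTo i w s)
  /-- The partner's coordinator wins but does not need this thread: steal from the partner tasks
  whose teams do not contain both threads. -/
  | help (c x w : Thread m) (ℓ : ℕ) (j : Level m) (hc : c = (s i).coord) (hℓ : ℓ = (s i).lev)
      (hx : x = partner i ℓ) (hw : w = (s x).coord) (hlt : ℓ < ((s c).req : ℕ)) (hne : w ≠ c)
      (h : (s w).req < (s c).req) (hℓw : ((s w).req : ℕ) ≤ ℓ)
      (hj : (j : ℕ) ≤ ℓ) (hq : (s x).queue j ≠ []) :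
      Poll i s (steal i x j ℓ s)
  /-- As before, but there is nothing to steal. -/
  | nothing (c x w : Thread m) (ℓ : ℕ) (hc : c = (s i).coord) (hℓ : ℓ = (s i).lev)
      (hx : x = partner i ℓ) (hw : w = (s x).coord) (hlt : ℓ < ((s c).req : ℕ)) (hne : w ≠ c)
      (h : (s w).req < (s c).req) (hℓw : ((s w).req : ℕ) ≤ ℓ)
      (hq : ∀ j : Level m, (j : ℕ) ≤ ℓ → (s x).queue j = []) :
      Poll i s (setLev i (ℓ + 1) s)

/-- One iteration of the loop of `stealTasks()`, executed by thread `i` with empty queues. -/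
inductive Seek (i : Thread m) (s : State m τ) : State m τ → Prop
  | done (h : m ≤ (s i).lev) : Seek i s (setLev i 0 s)
  /-- The partner's coordinator requires this thread: register. -/
  | join (x w : Thread m) (ℓ : ℕ) (hℓ : ℓ = (s i).lev) (hx : x = partner i ℓ)
      (hw : w = (s x).coord) (hlt : ℓ < m)
      (h : ℓ < ((s w).req : ℕ) ∧ SameTeam w i (s w).req) :
      Seek i s (register i w s)
  /-- Otherwise steal from the partner tasks whose teams do not contain both threads. -/
  | rob (x w : Thread m) (ℓ : ℕ) (j : Level m) (hℓ : ℓ = (s i).lev) (hx : x = partner i ℓ)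
      (hw : w = (s x).coord) (hlt : ℓ < m)
      (h : ¬(ℓ < ((s w).req : ℕ) ∧ SameTeam w i (s w).req))
      (hj : (j : ℕ) ≤ ℓ) (hq : amount x j ℓ s ≠ 0) :
      Seek i s (steal i x j ℓ s)
  | nothing (x w : Thread m) (ℓ : ℕ) (hℓ : ℓ = (s i).lev) (hx : x = partner i ℓ)
      (hw : w = (s x).coord) (hlt : ℓ < m)
      (h : ¬(ℓ < ((s w).req : ℕ) ∧ SameTeam w i (s w).req))
      (hq : ∀ j : Level m, (j : ℕ) ≤ ℓ → amount x j ℓ s = 0) :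
      Seek i s (setLev i (ℓ + 1) s)

/-- The state on which an iteration of the main loop of a thread without foreign coordinator
operates: at the head of its loop (`ℓ = 0`) the thread first settles its team. -/
noncomputable def headState (i : Thread m) (s : State m τ) : State m τ :=
  if (s i).lev = 0 then put s i (settle i (s i)) else s

/-- The coordinator `i` is at the head of its loop and its team is complete: `r = a`. -/
def Complete (i : Thread m) (s : State m τ) : Prop :=
  (s i).lev = 0 ∧ (s i).acq.card = 2 ^ ((s i).req : ℕ)

/-- One atomic step of thread `i`; `lv t` is the level of the task `t`, which requires
`2 ^ lv t` threads. -/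
inductive Step (lv : τ → Level m) (i : Thread m) (s : State m τ) : State m τ → Prop
  /-- A running thread computes. -/
  | work (h : (s i).run ≠ none) : Step lv i s s
  /-- A running thread spawns a task and pushes it to the bottom of its queue. -/
  | spawn (t : τ) (h : (s i).run ≠ none) (L : Local m τ)
      (hL : L = { s i with
        queue := Function.update (s i).queue (lv t) (t :: (s i).queue (lv t)) }) :
      Step lv i s (put s i (if (s i).coord = i then refresh i L else L))
  /-- A running thread finishes its part of the task. -/
  | finish (h : (s i).run ≠ none) : Step lv i s (put s i { s i with run := none, lev := 0 })
  /-- A thread of a team starts the task that its coordinator has published. -/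
  | start (c : Thread m) (hrun : (s i).run = none) (hc : c = (s i).coord) (hne : c ≠ i)
      (h : i ∈ (s c).pend) (s₁ : State m τ)
      (hs₁ : s₁ = put s c { s c with pend := (s c).pend.erase i }) :
      Step lv i s (put s₁ i { s₁ i with run := (s c).ready, lev := 0 })
  /-- A thread notices that its registration has been revoked. -/
  | revoked (c : Thread m) (hrun : (s i).run = none) (hc : c = (s i).coord) (hne : c ≠ i)
      (hp : i ∉ (s c).pend) (h : i ∉ (s c).acq) :
      Step lv i s (put s i (refresh i { s i with coord := i, lev := 0 }))
  /-- A teamed thread does nothing but wait for its coordinator. -/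
  | teamed (c : Thread m) (hrun : (s i).run = none) (hc : c = (s i).coord) (hne : c ≠ i)
      (hp : i ∉ (s c).pend) (ha : i ∈ (s c).acq) (h : SameTeam c i (s c).team) : Step lv i s s
  /-- A registered thread helps with the coordination. -/
  | member (c : Thread m) (hrun : (s i).run = none) (hc : c = (s i).coord) (hne : c ≠ i)
      (hp : i ∉ (s c).pend) (ha : i ∈ (s c).acq) (h : ¬SameTeam c i (s c).team)
      (s' : State m τ) (hs' : Poll i s s') : Step lv i s s'
  /-- A coordinator waits until its last task has been started by all threads of the team. -/
  | wait (hrun : (s i).run = none) (hc : (s i).coord = i) (h : (s i).pend ≠ ∅) : Step lv i s s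
  /-- A thread without tasks looks for work. -/
  | idle (hrun : (s i).run = none) (hc : (s i).coord = i) (hp : (s i).pend = ∅)
      (h : ¬HasTask (s i)) (s' : State m τ) (hs' : Seek i (headState i s) s') : Step lv i s s'
  /-- A coordinator with a complete team starts its task. -/
  | launch (hrun : (s i).run = none) (hc : (s i).coord = i) (hp : (s i).pend = ∅)
      (h : HasTask (s i)) (hcomp : Complete i (headState i s)) (t : τ) (rest : List τ)
      (hq : (headState i s i).queue (headState i s i).req = t :: rest) :
      Step lv i s (launch i t rest (headState i s))
  /-- A coordinator with an incomplete team polls its partners. -/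
  | coordinate (hrun : (s i).run = none) (hc : (s i).coord = i) (hp : (s i).pend = ∅)
      (h : HasTask (s i)) (hcomp : ¬Complete i (headState i s))
      (s' : State m τ) (hs' : Poll i (headState i s) s') : Step lv i s s'

/-- Initial states: arbitrary tasks in the queues, all threads are their own coordinators, nothing
is running. -/
def IsInitial (lv : τ → Level m) (s : State m τ) : Prop :=
  ∃ q : Thread m → Level m → List τ,
    (∀ i j, ∀ t ∈ q i j, lv t = j) ∧
    ∀ i, s i = refresh i
      { queue := q i, coord := i, req := 0, acq := {i}, team := 0, ready := none, pend := ∅,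
        run := none, lev := 0 }

/-- `s` is an execution of the scheduler in which thread `σ n` performs the `n`-th step. -/
def IsRun (lv : τ → Level m) (s : ℕ → State m τ) (σ : ℕ → Thread m) : Prop :=
  IsInitial lv (s 0) ∧ ∀ n, Step lv (σ n) (s n) (s (n + 1))

/-- Every thread keeps performing steps. -/
def Fair (σ : ℕ → Thread m) : Prop := ∀ i n, ∃ k ≥ n, σ k = i

/-- The computation is finite: only finitely many steps are spent on the execution of tasks. -/
def FiniteComputation (s : ℕ → State m τ) (σ : ℕ → Thread m) : Prop :=
  {n | (s n (σ n)).run ≠ none}.Finite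

/-- Thread `x` tries to coordinate a task (it then requires `2 ^ (s x).req` threads). -/
def Coordinating (s : State m τ) (x : Thread m) : Prop :=
  (s x).coord = x ∧ (s x).run = none ∧ (s x).pend = ∅ ∧ HasTask (s x)

/-- Two distinct threads try to coordinate tasks, and each is required for the other's team. -/
def Conflict (s : State m τ) (x y : Thread m) : Prop :=
  x ≠ y ∧ Coordinating s x ∧ Coordinating s y ∧
    SameTeam x y (s x).req ∧ SameTeam y x (s y).req

/-- `x` wins against `y`: smaller requirement, or equal requirements and smaller id. -/
def Beats (s : State m τ) (x y : Thread m) : Prop :=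
  (s x).req < (s y).req ∨ ((s x).req = (s y).req ∧ x < y)

/-- Thread `i` has the coordinator `w` and is actively registered there. -/
def Follows (s : State m τ) (i w : Thread m) : Prop :=
  (s i).coord = w ∧ i ∈ (s w).acq

/-- Thread `i`, on the side of the coordinator `y`, is currently free to switch. -/
def FreeToSwitch (s : State m τ) (i y : Thread m) : Prop :=
  i = y ∨ ((s i).run = none ∧ ¬SameTeam y i (s y).team)

/-- The step from `s` to `s'` resolves the conflict between `u` and `v` through `u`, while `v`
goes on as before: `u` stops coordinating and registers with a coordinator that wins against it
and requires it, or `u` goes on with a stolen task of smaller requirement whose team does not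
contain `v`. -/
def Yields (s s' : State m τ) (u v : Thread m) : Prop :=
  Coordinating s' v ∧ (s' v).req = (s v).req ∧
    ((∃ w, w ≠ u ∧ Beats s w u ∧ SameTeam w u (s w).req ∧ Follows s' u w) ∨
      (Coordinating s' u ∧ (s' u).req < (s u).req ∧ ¬SameTeam u v (s' u).req))

end TeamBuilding

/-! The claims about single steps rest on an invariant (`LocalInv`, `Inv`): the registered set of a
thread lies between its team block and its required block, a thread with positive requirement is its
own coordinator, and whoever is listed as registered with `w` refers to `w`. Of two threads in
conflict each is required by the other but not registered there, so neither team is complete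
(`Conflict.not_complete`). Hence both can only poll, without a team and with unchanged requirement,
and a polling step merely changes `ℓ`, moves to a better coordinator, or steals tasks of smaller
requirement (`Outcome`). A follower of the winner lies in the winner's block; a required thread can
therefore meet it only at a level below the winner's requirement, where the polling rules force the
switch (`Poll.follows_winner`).

By `Conflict.step` a conflict either persists or ends in one of the admissible ways, so it suffices
that no thread coordinates forever (`IsRun.not_coordinating_forever`). In a finite computation, from
some time on nothing runs, is published or is launched, all teams have vanished, and the set of
nonempty queues is constant, because thefts never empty a deque (`IsRun.eventually_quiet`). From
then on requirements are frozen and winning means having smaller value of a fixed injective `rank`.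
An induction on the rank with a nonincreasing potential shows that every thread finally keeps one
coordinator (`IsRun.eventually_follows`).

Let `z` have least rank among the permanent coordinators with tasks. A required thread that does not
follow `z`, while a partner below the requirement of `z` does, would reach that partner in its scan
and switch (`Stable.scan`). Bit flips connect the block, so all required threads follow `z`. Then
`z` returns to the head of its loop with a complete team and has to launch, a contradiction
(`Stable.scan_coordinator`). -/

namespace TeamBuilding

open Filter

variable {m : ℕ} {τ : Type*}

/-! ### Blocks and partners -/

/-- Working with the high bits of the ids reduces every question about partners to the single bit
that is flipped. -/
theorem sameTeam_iff {x y : Thread m} {k : Level m} :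
    SameTeam x y k ↔ ∀ t, (k : ℕ) ≤ t → (x : ℕ).testBit t = (y : ℕ).testBit t := by
  unfold SameTeam
  constructor
  · intro h t ht
    obtain ⟨d, rfl⟩ := Nat.exists_eq_add_of_le ht
    have hb : ∀ n : ℕ, n.testBit (k + d) = (n / 2 ^ (k : ℕ)).testBit d := fun n => by
      rw [Nat.testBit_div_two_pow, add_comm]
    rw [hb, hb, h]
  · intro h
    apply Nat.eq_of_testBit_eq
    intro t
    rw [Nat.testBit_div_two_pow, Nat.testBit_div_two_pow]
    exact h _ (by omega)

theorem SameTeam.refl (x : Thread m) (k : Level m) : SameTeam x x k := rfl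

theorem SameTeam.symm {x y : Thread m} {k : Level m} (h : SameTeam x y k) : SameTeam y x k :=
  Eq.symm h

theorem SameTeam.trans {x y z : Thread m} {k : Level m} (h : SameTeam x y k)
    (h' : SameTeam y z k) : SameTeam x z k :=
  Eq.trans h h'

theorem SameTeam.mono {x y : Thread m} {k l : Level m} (h : SameTeam x y k) (hkl : k ≤ l) :
    SameTeam x y l := by
  rw [sameTeam_iff] at *
  exact fun t ht => h t (le_trans hkl ht)

theorem sameTeam_zero {x y : Thread m} : SameTeam x y 0 ↔ x = y := by
  simp [SameTeam, Fin.ext_iff]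

theorem partner_val (i : Thread m) {ℓ : ℕ} (h : ℓ < m) :
    (partner i ℓ : ℕ) = (i : ℕ) ^^^ 2 ^ ℓ :=
  Nat.mod_eq_of_lt (Nat.xor_lt_two_pow i.2 (Nat.pow_lt_pow_right (by norm_num) h))

theorem partner_of_le (i : Thread m) {ℓ : ℕ} (h : m ≤ ℓ) : partner i ℓ = i := by
  apply Fin.ext
  apply Nat.eq_of_testBit_eq
  intro t
  simp only [partner, Nat.testBit_mod_two_pow, Nat.testBit_xor, Nat.testBit_two_pow]
  by_cases ht : t < m
  · have : ¬ ℓ = t := by omega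
    simp [ht, this]
  · have : (i : ℕ) < 2 ^ t := lt_of_lt_of_le i.2 (Nat.pow_le_pow_right (by norm_num) (by omega))
    simp [ht, Nat.testBit_lt_two_pow this]

theorem partner_partner (i : Thread m) (ℓ : ℕ) : partner (partner i ℓ) ℓ = i := by
  by_cases h : ℓ < m
  · apply Fin.ext
    rw [partner_val _ h, partner_val _ h, Nat.xor_assoc, Nat.xor_self, Nat.xor_zero]
  · rw [partner_of_le _ (not_lt.1 h), partner_of_le _ (not_lt.1 h)]

theorem sameTeam_partner (i : Thread m) {ℓ : ℕ} {k : Level m} (h : ℓ < k) :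
    SameTeam i (partner i ℓ) k := by
  rw [sameTeam_iff]
  intro t ht
  have : ¬ ℓ = t := by omega
  rw [partner_val _ (by omega), Nat.testBit_xor, Nat.testBit_two_pow]
  simp [this]

theorem not_sameTeam_partner (i : Thread m) {ℓ : ℕ} {k : Level m} (h : k ≤ ℓ) (hm : ℓ < m) :
    ¬ SameTeam i (partner i ℓ) k := by
  rw [sameTeam_iff]
  intro H
  have := H ℓ h
  rw [partner_val _ hm, Nat.testBit_xor, Nat.testBit_two_pow] at this
  simp at this

theorem partner_ne (i : Thread m) {ℓ : ℕ} (hm : ℓ < m) : partner i ℓ ≠ i := by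
  intro h
  apply not_sameTeam_partner i (k := 0) (Nat.zero_le _) hm
  rw [h]
  exact SameTeam.refl _ _

/-- A block splits into two halves that are exchanged by flipping its top free bit; this is the
induction step of `sameTeam_induction`. -/
theorem sameTeam_succ {a b : Thread m} {k l : Level m} (hl : (l : ℕ) = k + 1)
    (h : SameTeam a b l) : SameTeam a b k ∨ SameTeam (partner a k) b k := by
  have hk : (k : ℕ) < m := by omega
  simp only [sameTeam_iff] at *
  by_cases hb : (a : ℕ).testBit k = (b : ℕ).testBit k
  · left
    intro t ht
    rcases eq_or_lt_of_le ht with rfl | h'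
    · exact hb
    · exact h t (by omega)
  · right
    intro t ht
    rw [partner_val _ hk, Nat.testBit_xor, Nat.testBit_two_pow]
    rcases eq_or_lt_of_le ht with rfl | h'
    · revert hb
      cases (a : ℕ).testBit k <;> cases (b : ℕ).testBit k <;> simp
    · have : ¬ (k : ℕ) = t := by omega
      simp [this, h t (by omega)]

/-- A set of threads that contains `a` and is closed under the partner relation at the levels
below `k` contains the whole team of size `2 ^ k` of `a`. -/
theorem sameTeam_induction {P : Thread m → Prop} (k : Level m)
    (hP : ∀ i ℓ, ℓ < (k : ℕ) → P i → P (partner i ℓ)) {a b : Thread m} (ha : P a)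
    (h : SameTeam a b k) : P b := by
  obtain ⟨k, hk⟩ := k
  induction k generalizing a with
  | zero =>
    have : a = b := sameTeam_zero.1 h
    exact this ▸ ha
  | succ k ih =>
    have ih' := fun {a} => ih (a := a) (hk := by omega) (hP := fun i ℓ hℓ => hP i ℓ (Nat.lt_succ_of_lt hℓ))
    rcases sameTeam_succ (k := ⟨k, by omega⟩) rfl h with h' | h'
    · exact ih' ha h'
    · exact ih' (hP a k (Nat.lt_succ_self k) ha) h'

@[simp]
theorem mem_block {x y : Thread m} {k : Level m} : y ∈ block x k ↔ SameTeam x y k := by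
  simp [block]

theorem block_zero (x : Thread m) : block x 0 = {x} := by
  ext y
  simp [sameTeam_zero, eq_comm]

theorem block_mono (x : Thread m) {k l : Level m} (h : k ≤ l) : block x k ⊆ block x l := by
  intro y
  simp only [mem_block]
  exact fun h' => h'.mono h

theorem card_block (x : Thread m) (k : Level m) : (block x k).card = 2 ^ (k : ℕ) := by
  have h1 : (block x k).map Fin.valEmbedding =
      Finset.Ico ((x : ℕ) / 2 ^ (k : ℕ) * 2 ^ (k : ℕ))
        ((x : ℕ) / 2 ^ (k : ℕ) * 2 ^ (k : ℕ) + 2 ^ (k : ℕ)) := by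
    have hpos : 0 < 2 ^ (k : ℕ) := Nat.two_pow_pos _
    ext y
    simp only [Finset.mem_map, mem_block, Fin.valEmbedding_apply, Finset.mem_Ico]
    constructor
    · rintro ⟨y, hy, rfl⟩
      unfold SameTeam at hy
      rw [hy]
      have := Nat.div_add_mod (y : ℕ) (2 ^ (k : ℕ))
      have := Nat.mod_lt (y : ℕ) hpos
      rw [mul_comm]
      omega
    · rintro ⟨h1, h2⟩
      have hq : y / 2 ^ (k : ℕ) = (x : ℕ) / 2 ^ (k : ℕ) := by
        apply Nat.div_eq_of_lt_le
        · exact h1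
        · rw [Nat.add_mul, one_mul]
          exact h2
      -- The block size divides `2 ^ m`, so the interval does not run past the last thread id.
      have hm : 2 ^ m = 2 ^ (m - (k : ℕ)) * 2 ^ (k : ℕ) := by
        rw [← pow_add]
        congr 1
        omega
      have hy : y < 2 ^ m := by
        rw [hm, ← Nat.div_lt_iff_lt_mul hpos, hq, Nat.div_lt_iff_lt_mul hpos, ← hm]
        exact x.2
      exact ⟨⟨y, hy⟩, hq.symm, rfl⟩
  rw [← Finset.card_map Fin.valEmbedding, h1]
  simp

/-! ### The least requirement in the queues -/

theorem smallest_cases (d : Level m) (q : Level m → List τ) :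
    ((∀ j, q j = []) ∧ smallest d q = d) ∨
      (q (smallest d q) ≠ [] ∧ ∀ j, q j ≠ [] → smallest d q ≤ j) := by
  unfold smallest
  rcases hm : (Finset.univ.filter fun j => (q j).length ≠ 0).min with _ | k
  · left
    have := Finset.min_eq_top.1 hm
    refine ⟨fun j => ?_, rfl⟩
    by_contra hj
    have : j ∈ (Finset.univ.filter fun j => (q j).length ≠ 0) := by simpa using hj
    simp_all
  · right
    have h1 := Finset.mem_of_min hm
    refine ⟨by
      change q k ≠ []
      simpa using h1, fun j hj => ?_⟩
    have : j ∈ (Finset.univ.filter fun j => (q j).length ≠ 0) := by simpa using hj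
    exact Finset.min_le_of_eq this hm

theorem smallest_le {d : Level m} {q : Level m → List τ} {j : Level m} (h : q j ≠ []) :
    smallest d q ≤ j := by
  rcases smallest_cases d q with h' | h'
  · exact absurd (h'.1 j) h
  · exact h'.2 j h

theorem smallest_mem (d : Level m) {L : Local m τ} (h : HasTask L) :
    L.queue (smallest d L.queue) ≠ [] := by
  rcases smallest_cases d L.queue with h' | h'
  · obtain ⟨j, hj⟩ := h
    exact absurd (h'.1 j) hj
  · exact h'.1

theorem smallest_of_not (d : Level m) {L : Local m τ} (h : ¬ HasTask L) :
    smallest d L.queue = d := by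
  rcases smallest_cases d L.queue with h' | h'
  · exact h'.2
  · exact absurd ⟨_, h'.1⟩ h

theorem smallest_congr (d : Level m) {q q' : Level m → List τ}
    (h : ∀ j, q j = [] ↔ q' j = []) : smallest d q = smallest d q' := by
  unfold smallest
  congr 2
  ext j
  simp [h j]

theorem hasTask_congr {L L' : Local m τ} (h : ∀ j, L.queue j = [] ↔ L'.queue j = []) :
    HasTask L ↔ HasTask L' := by
  simp [HasTask, h]

/-! ### Invariants -/

/-- The part of the invariant that concerns the data of a single thread `i`. -/
structure LocalInv (i : Thread m) (L : Local m τ) : Prop where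
  inactive : L.coord ≠ i → L.req = 0 ∧ L.team = 0 ∧ L.pend = ∅
  req_eq : L.coord = i → L.req = max L.team (smallest L.team L.queue)
  team_sub : block i L.team ⊆ L.acq
  acq_sub : L.acq ⊆ block i L.req
  pend_team : ∀ z ∈ L.pend, z ≠ i ∧ SameTeam i z L.team
  ready : L.pend ≠ ∅ → L.ready ≠ none
  -- Away from `ℓ = 0` the head of the loop has been passed, so the team is already settled; this
  -- makes `headState` harmless at every level.
  polling : L.coord = i → L.run = none → L.lev ≠ 0 → L.team = 0 ∧ (HasTask L → 0 < L.req)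

/-- The invariant of the scheduler. -/
structure Inv (s : State m τ) : Prop where
  loc : ∀ i, LocalInv i (s i)
  -- The converse fails: a thread may still refer to a coordinator that has dropped it, which is the
  -- situation of `revoked`.
  coord_eq : ∀ z w, z ∈ (s w).acq → z ≠ w → (s z).coord = w

namespace LocalInv

variable {i : Thread m} {L : Local m τ}

theorem acq_eq_of_req (h : LocalInv i L) (hr : L.req = 0) : L.acq = {i} := by
  apply Finset.Subset.antisymm
  · have := h.acq_sub
    rwa [hr, block_zero] at this
  · rw [← block_zero]
    exact (block_mono i (Fin.zero_le _)).trans h.team_sub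

theorem mem_acq (h : LocalInv i L) : i ∈ L.acq :=
  h.team_sub (mem_block.2 (SameTeam.refl _ _))

theorem coord_of_req (h : LocalInv i L) (hr : 0 < L.req) : L.coord = i := by
  by_contra hc
  rw [(h.inactive hc).1] at hr
  exact lt_irrefl _ hr

theorem acq_eq_block (h : LocalInv i L) (hc : L.acq.card = 2 ^ (L.req : ℕ)) :
    L.acq = block i L.req :=
  Finset.eq_of_subset_of_card_le h.acq_sub (by rw [card_block, hc])

/-- With empty queues the default value of `smallest` is the team itself, so the requirement could
not exceed the team. -/
theorem hasTask_of_lt (h : LocalInv i L) (hc : L.coord = i) (hlt : L.team < L.req) :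
    HasTask L := by
  by_contra ht
  have h1 := h.req_eq hc
  rw [smallest_of_not _ ht, max_self] at h1
  exact hlt.ne' h1

/-- The invariant is restored by `refresh`. -/
theorem refresh (hc : L.coord = i) (h1 : block i L.team ⊆ L.acq) (h2 : L.acq ⊆ block i L.req)
    (h3 : ∀ z ∈ L.pend, z ≠ i ∧ SameTeam i z L.team) (h4 : L.pend ≠ ∅ → L.ready ≠ none)
    (h5 : L.run = none → L.lev = 0) : LocalInv i (refresh i L) where
  inactive h := absurd hc h
  req_eq _ := rfl
  team_sub := by
    simp only [TeamBuilding.refresh]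
    split_ifs
    · exact Finset.Subset.rfl
    · exact h1
  acq_sub := by
    simp only [TeamBuilding.refresh]
    split_ifs with h
    · exact block_mono i (le_max_left _ _)
    · exact h2.trans (block_mono i (not_lt.1 h))
  pend_team := h3
  ready := h4
  polling _ hr hl := absurd (h5 hr) hl

theorem refresh_acq_subset (h1 : block i L.team ⊆ L.acq) :
    (TeamBuilding.refresh i L).acq ⊆ L.acq := by
  simp only [TeamBuilding.refresh]
  split_ifs
  · exact h1
  · exact Finset.Subset.rfl

/-- What `settle` does for a thread that satisfies the invariant: either the team is complete
afterwards, or at most the acquired threads are given up and the team is dissolved. -/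
theorem settle_spec (h : LocalInv i L) (hc : L.coord = i) (ht : HasTask L) :
    (∃ k, k ≤ L.team ∧ L.queue k ≠ [] ∧ L.req = L.team ∧
      settle i L = { L with team := k, req := k, acq := block i k }) ∨
    (L.team < L.req ∧ 0 < L.team ∧ settle i L = { L with team := 0, acq := {i} }) ∨
    (L.team = 0 ∧ 0 < L.req ∧ settle i L = L) := by
  have hreq := h.req_eq hc
  unfold settle
  rw [if_pos ht]
  by_cases hq : L.queue L.team ≠ []
  · left
    simp only [hq, if_true, le_refl, ne_eq, not_false_eq_true]
    refine ⟨_, le_rfl, hq, ?_, rfl⟩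
    rw [hreq, max_eq_left (smallest_le hq)]
  · simp only [hq, if_false]
    by_cases hk : smallest L.team L.queue ≤ L.team
    · left
      refine ⟨_, hk, smallest_mem _ ht, ?_, by rw [if_pos hk]⟩
      rw [hreq, max_eq_left hk]
    · right
      rw [if_neg hk]
      have hk' := not_le.1 hk
      have hr : L.req = smallest L.team L.queue := by rw [hreq, max_eq_right hk'.le]
      rw [← hr] at hk' ⊢
      by_cases h0 : 0 < L.team
      · left
        exact ⟨hk', h0, by rw [if_pos (Or.inl h0)]⟩
      · right
        have h0' : L.team = 0 := le_antisymm (not_lt.1 h0) (Fin.zero_le _)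
        refine ⟨h0', by rwa [h0'] at hk', ?_⟩
        rw [if_neg (by simp [h0])]

theorem settle_of_not (ht : ¬ HasTask L) :
    settle i L = { L with team := 0, req := 0, acq := {i} } := by
  unfold settle
  rw [if_neg ht]

/-- In a thread without a team there is nothing to settle. -/
theorem settle_eq_self (h : LocalInv i L) (hc : L.coord = i) (h0 : L.team = 0) :
    settle i L = L := by
  by_cases ht : HasTask L
  · rcases h.settle_spec hc ht with ⟨k, hk, -, hr, he⟩ | ⟨-, h', -⟩ | ⟨-, -, he⟩
    · have hk0 : k = 0 := le_antisymm (hk.trans_eq h0) (Fin.zero_le _)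
      rw [he, hk0, block_zero, ← h.acq_eq_of_req (hr.trans h0)]
      have h1 := hr.trans h0
      cases L
      simp_all
    · exact absurd h0 h'.ne'
    · exact he
  · have h1 := h.req_eq hc
    rw [smallest_of_not _ ht, max_self, h0] at h1
    rw [settle_of_not ht, ← h.acq_eq_of_req h1]
    cases L
    simp_all

theorem settle (h : LocalInv i L) (hc : L.coord = i) (hp : L.pend = ∅) (hl : L.lev = 0) :
    LocalInv i (settle i L) := by
  by_cases ht : HasTask L
  · rcases h.settle_spec hc ht with ⟨k, hk, hq, hr, he⟩ | ⟨hlt, h0, he⟩ | ⟨-, -, he⟩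
    · rw [he]
      exact
        { inactive := fun h => absurd hc h
          req_eq := fun _ => (max_eq_left (smallest_le hq)).symm
          team_sub := Finset.Subset.rfl
          acq_sub := Finset.Subset.rfl
          pend_team := by simp [hp]
          ready := by simp [hp]
          polling := fun _ _ h => absurd hl h }
    · rw [he]
      have hreq := h.req_eq hc
      exact
        { inactive := fun h => absurd hc h
          req_eq := fun _ => by
            -- Disbanding replaces the default of `smallest` by `0`; since some queue is nonempty,
            -- the default is not used.
            have hs : smallest L.team L.queue = smallest 0 L.queue := by
              rcases smallest_cases L.team L.queue with h1 | h1
              · obtain ⟨j, hj⟩ := ht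
                exact absurd (h1.1 j) hj
              · apply le_antisymm
                · exact h1.2 _ (smallest_mem 0 ht)
                · exact smallest_le h1.1
            change L.req = max 0 (smallest 0 L.queue)
            rw [max_eq_right (Fin.zero_le _), ← hs]
            rcases max_choice L.team (smallest L.team L.queue) with h3 | h3
            · rw [h3] at hreq
              exact absurd hreq hlt.ne'
            · rw [hreq, h3]
          team_sub := by rw [block_zero]
          acq_sub := by
            rw [← block_zero]
            exact block_mono i (Fin.zero_le _)
          pend_team := by simp [hp]
          ready := by simp [hp]
          polling := fun _ _ h => absurd hl h }
    · rwa [he]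
  · rw [settle_of_not ht]
    exact
      { inactive := fun h => absurd hc h
        req_eq := fun _ => by
          have := smallest_of_not 0 ht
          change (0 : Level m) = max 0 (smallest 0 L.queue)
          rw [this, max_self]
        team_sub := by rw [block_zero]
        acq_sub := by rw [block_zero]
        pend_team := by simp [hp]
        ready := by simp [hp]
        polling := fun _ _ h => absurd hl h }

theorem settle_acq_subset (h : LocalInv i L) (hc : L.coord = i) :
    (TeamBuilding.settle i L).acq ⊆ L.acq := by
  by_cases ht : HasTask L
  · rcases h.settle_spec hc ht with ⟨k, hk, hq, hr, he⟩ | ⟨hlt, h0, he⟩ | ⟨-, -, he⟩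
    · rw [he]
      exact (block_mono i hk).trans h.team_sub
    · rw [he]
      simpa using h.mem_acq
    · rw [he]
  · rw [settle_of_not ht]
    simpa using h.mem_acq

end LocalInv

/-! ### Single updates -/

@[simp]
theorem put_self (s : State m τ) (i : Thread m) (L : Local m τ) : put s i L i = L := by
  simp [put]

@[simp]
theorem put_of_ne (s : State m τ) {i z : Thread m} (L : Local m τ) (h : z ≠ i) :
    put s i L z = s z := by
  simp [put, h]

theorem put_eq_self (s : State m τ) (i : Thread m) : put s i (s i) = s := by
  simp [put]

theorem setLev_self (s : State m τ) (i : Thread m) (ℓ : ℕ) :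
    setLev i ℓ s i = { s i with lev := ℓ } := by
  simp [setLev]

theorem setLev_of_ne (s : State m τ) {i z : Thread m} (ℓ : ℕ) (h : z ≠ i) :
    setLev i ℓ s z = s z := by
  simp [setLev, h]

/-- The state after thread `i` has given up its previous role and registered with `w`. -/
def moved (i w : Thread m) (s : State m τ) : State m τ := fun z =>
  if z = i then { s i with coord := w, lev := 0, req := 0, team := 0, acq := {i} }
  else { s z with acq := if z = w then insert i (s z).acq else (s z).acq.erase i }

/-- The state after thread `i` has become its own coordinator with `l` additional tasks, while
the queue for `2 ^ j` threads of `x` has been cut to its first `n` tasks. -/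
def robbed (i x : Thread m) (j : Level m) (n : ℕ) (l : List τ) (s : State m τ) : State m τ :=
  fun z =>
    if z = i then refresh i
      { s i with
        coord := i
        queue := Function.update (s i).queue j (l ++ (s i).queue j)
        lev := 0 }
    else
      { s z with
        acq := (s z).acq.erase i
        queue := if z = x then Function.update (s z).queue j (((s z).queue j).take n)
          else (s z).queue }

namespace Inv

variable {s : State m τ} {i w x : Thread m}

theorem not_mem_acq (h : Inv s) {z : Thread m} (hz : z ≠ i) (hc : (s i).coord ≠ z) :
    i ∉ (s z).acq :=
  fun hm => hc (h.coord_eq i z hm hz.symm)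

theorem acq_of_inactive (h : Inv s) (hc : (s i).coord ≠ i) : (s i).acq = {i} :=
  (h.loc i).acq_eq_of_req ((h.loc i).inactive hc).1

/-- `moved` erases `i` from the list of every other thread except `w`, while the algorithm touches
one list only. Both agree because, by `coord_eq`, apart from `i` only its coordinator can list `i`.
The hypotheses on `w` keep the updated entries distinct. -/
theorem leave_register (h : Inv s) (hwi : w ≠ i) (hwc : w ≠ (s i).coord) :
    register i w (leave i s) = moved i w s := by
  funext z
  unfold register leave moved
  by_cases hc : (s i).coord = i
  · simp only [hc, if_true]
    by_cases hz : z = i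
    · subst hz
      simp [hwi.symm]
    · by_cases hzw : z = w
      · subst hzw
        simp [hz]
      · have := h.not_mem_acq (i := i) (z := z) hz (by rw [hc]; exact Ne.symm hz)
        simp [hz, hzw, this]
  · simp only [hc, if_false]
    have hc' : i ≠ (s i).coord := Ne.symm hc
    obtain ⟨h1, h2, -⟩ := (h.loc i).inactive hc
    have h3 := h.acq_of_inactive hc
    by_cases hz : z = i
    · subst hz
      simp only [put_self, put_of_ne _ _ hwi.symm, put_of_ne _ _ hc', if_true]
      cases hs : s z
      simp_all
    · by_cases hzw : z = w
      · subst hzw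
        simp [hz, hwc]
      · by_cases hzc : z = (s i).coord
        · rw [← hzc] at hwc ⊢
          simp [hz, hzw]
        · have := h.not_mem_acq (i := i) (z := z) hz (Ne.symm hzc)
          simp [hz, hzw, this, hzc]

/-- A thread with neither requirement nor team has nothing to give up, so leaving first would be the
identity. -/
theorem register_idle (h : Inv s) (hwi : w ≠ i) (hc : (s i).coord = i) (hr : (s i).req = 0)
    (ht : (s i).team = 0) : register i w s = moved i w s := by
  rw [← h.leave_register hwi (by rwa [hc])]
  unfold leave
  rw [if_pos hc]
  congr 1
  rw [← (h.loc i).acq_eq_of_req hr]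
  conv_lhs => rw [← put_eq_self s i]
  congr 1
  cases hs : s i
  simp_all

theorem steal_eq (h : Inv s) (hx : x ≠ i) (j : Level m) (ℓ : ℕ) (ha : amount x j ℓ s ≠ 0) :
    steal i x j ℓ s = robbed i x j (((s x).queue j).length - amount x j ℓ s)
      (((s x).queue j).drop (((s x).queue j).length - amount x j ℓ s)) s := by
  funext z
  unfold steal robbed detach leave
  simp only [ha, if_false]
  by_cases hc : (s i).coord = i
  · simp only [hc, if_true]
    by_cases hz : z = i
    · subst hz
      simp only [put_self, put_of_ne _ _ hx.symm, if_true]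
      cases hs : s z
      simp_all
    · have := h.not_mem_acq (i := i) (z := z) hz (by rw [hc]; exact Ne.symm hz)
      by_cases hzx : z = x
      · subst hzx
        simp [hz, this]
      · simp [hz, hzx, this]
  · simp only [hc, if_false]
    have hc' : i ≠ (s i).coord := Ne.symm hc
    by_cases hz : z = i
    · subst hz
      simp only [put_self, put_of_ne _ _ hx.symm, put_of_ne _ _ hc', if_true]
    · by_cases hzc : z = (s i).coord
      · rw [← hzc]
        by_cases hzx : z = x
        · subst hzx
          simp [hz]
        · simp [hz, hzx]
      · have := h.not_mem_acq (i := i) (z := z) hz (Ne.symm hzc)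
        by_cases hzx : z = x
        · subst hzx
          simp [hz, this, hzc]
        · simp [hz, this, hzc, hzx]

theorem switchTo_eq (h : Inv s) (hwi : w ≠ i) (hwc : w ≠ (s i).coord) :
    switchTo i w s = if SameTeam w i (s w).req then moved i w s else setLev i 0 s := by
  unfold switchTo
  rw [h.leave_register hwi hwc]

end Inv

/-- These are the only changes that other threads can inflict: they preserve which queues are empty,
hence also the requirement. -/
theorem LocalInv.update {i : Thread m} {L : Local m τ} (h : LocalInv i L)
    {q : Level m → List τ} {a p : Finset (Thread m)} (hq : ∀ j, q j = [] ↔ L.queue j = [])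
    (h1 : block i L.team ⊆ a) (h2 : a ⊆ block i L.req) (h3 : p ⊆ L.pend) :
    LocalInv i { L with queue := q, acq := a, pend := p } where
  inactive hc := by
    obtain ⟨h4, h5, h6⟩ := h.inactive hc
    exact ⟨h4, h5, Finset.subset_empty.1 (h6 ▸ h3)⟩
  req_eq hc := by
    change L.req = max L.team (smallest L.team q)
    rw [h.req_eq hc, smallest_congr _ hq]
  team_sub := h1
  acq_sub := h2
  pend_team z hz := h.pend_team z (h3 hz)
  ready hp := h.ready fun h' => hp (Finset.subset_empty.1 (h' ▸ h3))
  polling hc hr hl := by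
    obtain ⟨h4, h5⟩ := h.polling hc hr hl
    exact ⟨h4, fun ht => h5 ((hasTask_congr hq).1 ht)⟩

/-- Thread `i` is in a position to inspect a partner. -/
structure CanPoll (i : Thread m) (s : State m τ) : Prop where
  inv : Inv s
  pend : (s i).pend = ∅
  run : (s i).run = none
  team : (s i).coord = i → (s i).team = 0
  req_pos : (s i).coord = i → HasTask (s i) → 0 < (s i).req
  mem : i ∈ (s (s i).coord).acq
  free : (s i).coord ≠ i → ¬ SameTeam (s i).coord i (s (s i).coord).team

/-- The possible effects of inspecting a partner. -/
inductive Outcome (i : Thread m) (s : State m τ) : State m τ → Prop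
  | lev (ℓ : ℕ) : Outcome i s (setLev i ℓ s)
  | move (w : Thread m) (hwi : w ≠ i) (hwc : w ≠ (s i).coord) (hr : 0 < (s w).req)
      (hb : HasTask (s i) ∨ (s i).coord ≠ i → Beats s w (s i).coord)
      (ht : SameTeam w i (s w).req) : Outcome i s (moved i w s)
  | rob (x : Thread m) (j : Level m) (n : ℕ) (l : List τ) (hx : x ≠ i) (hn : 0 < n) (hl : l ≠ [])
      (hj : HasTask (s i) ∨ (s i).coord ≠ i → j < (s (s i).coord).req) :
      Outcome i s (robbed i x j n l s)

/-- At most half of a deque is taken, so a robbed deque keeps a task (`0 < n`) and its owner's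
requirement is unaffected. -/
theorem steal_cases {s : State m τ} (h : Inv s) {i x : Thread m} (hx : x ≠ i) (j : Level m)
    (ℓ : ℕ) : (amount x j ℓ s = 0 ∧ steal i x j ℓ s = setLev i 0 s) ∨
      ∃ n l, 0 < n ∧ l ≠ [] ∧ steal i x j ℓ s = robbed i x j n l s := by
  by_cases ha : amount x j ℓ s = 0
  · left
    exact ⟨ha, by simp [steal, ha]⟩
  · right
    have h1 : amount x j ℓ s ≤ ((s x).queue j).length / 2 := min_le_left _ _
    refine ⟨_, _, ?_, ?_, h.steal_eq hx j ℓ ha⟩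
    · omega
    · intro h0
      have := congrArg List.length h0
      simp only [List.length_drop, List.length_nil] at this
      omega

/-- A thread with a positive requirement that is not the coordinator of a polling thread is not
this thread itself. -/
theorem CanPoll.ne_of_req_pos {i w : Thread m} {s : State m τ} (h : CanPoll i s)
    (hw : 0 < (s w).req) (hwc : w ≠ (s i).coord) : w ≠ i := by
  rintro rfl
  exact hwc ((h.inv.loc w).coord_of_req hw).symm

theorem Poll.outcome {i : Thread m} {s s' : State m τ} (h : CanPoll i s) (hp : Poll i s s') :
    Outcome i s s' := by
  cases hp with
  | done => exact .lev _
  | skip => exact .lev _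
  | nothing => exact .lev _
  | switch c x w ℓ hc hℓ hx hw hlt hne hb =>
    subst hc
    -- In both cases the current level lies below the requirement of `w`; positivity makes `w` its
    -- own coordinator and so different from `i`.
    have hr : 0 < (s w).req := by
      rcases hb with ⟨h1, -⟩ | ⟨-, h1⟩
      · rw [h1]
        exact Fin.lt_def.2 (lt_of_le_of_lt (Nat.zero_le _) hlt)
      · exact Fin.lt_def.2 (lt_of_le_of_lt (Nat.zero_le _) h1)
    have hwi := h.ne_of_req_pos hr hne
    rw [h.inv.switchTo_eq hwi hne]
    split_ifs with ht
    · refine .move w hwi hne hr (fun _ => ?_) ht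
      rcases hb with h1 | h1
      · exact Or.inr h1
      · exact Or.inl h1.1
    · exact .lev _
  | help c x w ℓ j hc hℓ hx hw hlt hne hb hℓw hj hq =>
    subst hc
    have hxi : x ≠ i := by
      rw [hx]
      exact partner_ne i (by omega)
    rcases steal_cases h.inv hxi j ℓ with ⟨-, he⟩ | ⟨n, l, hn, hl, he⟩
    · rw [he]
      exact .lev _
    · rw [he]
      exact .rob x j n l hxi hn hl (fun _ => Fin.lt_def.2 (lt_of_le_of_lt hj hlt))

theorem Seek.outcome {i : Thread m} {s s' : State m τ} (h : CanPoll i s)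
    (hc : (s i).coord = i) (ht : ¬ HasTask (s i)) (hp : Seek i s s') : Outcome i s s' := by
  have hr : (s i).req = 0 := by
    rw [(h.inv.loc i).req_eq hc, smallest_of_not _ ht, max_self, h.team hc]
  -- An idle thread owes no comparison with its former coordinator: the side conditions in `Outcome`
  -- are vacuous for it.
  have hn : ¬ (HasTask (s i) ∨ (s i).coord ≠ i) := by simp [hc, ht]
  cases hp with
  | done => exact .lev _
  | nothing => exact .lev _
  | join x w ℓ hℓ hx hw hlt hb =>
    have hrw : 0 < (s w).req := Fin.lt_def.2 (lt_of_le_of_lt (Nat.zero_le _) hb.1)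
    have hwi : w ≠ i := by
      rintro rfl
      rw [hr] at hrw
      exact lt_irrefl _ hrw
    rw [h.inv.register_idle hwi hc hr (h.team hc)]
    exact .move w hwi (by rwa [hc]) hrw (fun h' => absurd h' hn) hb.2
  | rob x w ℓ j hℓ hx hw hlt hb hj hq =>
    have hxi : x ≠ i := by
      rw [hx]
      exact partner_ne i (by omega)
    rcases steal_cases h.inv hxi j ℓ with ⟨h0, -⟩ | ⟨n, l, hn', hl, he⟩
    · exact absurd h0 hq
    · rw [he]
      exact .rob x j n l hxi hn' hl (fun h' => absurd h' hn)

/-! ### Preservation of the invariant. -/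

namespace Inv

variable {s s' : State m τ} {i : Thread m}

theorem put (h : Inv s) {L : Local m τ} (hL : LocalInv i L) (ha : L.acq ⊆ (s i).acq)
    (hc : ∀ w, w ≠ i → i ∈ (s w).acq → L.coord = w) : Inv (put s i L) where
  loc z := by
    by_cases hz : z = i
    · subst hz
      rwa [put_self]
    · rw [put_of_ne _ _ hz]
      exact h.loc z
  coord_eq z w hz hzw := by
    by_cases hzi : z = i
    · subst hzi
      rw [put_self]
      rw [put_of_ne _ _ hzw.symm] at hz
      exact hc w hzw.symm hz
    · rw [put_of_ne _ _ hzi]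
      by_cases hwi : w = i
      · subst hwi
        rw [put_self] at hz
        exact h.coord_eq z w (ha hz) hzw
      · rw [put_of_ne _ _ hwi] at hz
        exact h.coord_eq z w hz hzw

theorem headState (h : Inv s) (hc : (s i).coord = i) (hp : (s i).pend = ∅) :
    Inv (headState i s) := by
  unfold TeamBuilding.headState
  split_ifs with hl
  · refine h.put ((h.loc i).settle hc hp hl) ((h.loc i).settle_acq_subset hc) ?_
    intro w hw hm
    have : (settle i (s i)).coord = (s i).coord := by
      unfold settle
      dsimp only
      split_ifs <;> rfl
    rw [this]
    exact h.coord_eq i w hm hw.symm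
  · exact h

end Inv

theorem headState_of_ne {s : State m τ} {i z : Thread m} (hz : z ≠ i) :
    headState i s z = s z := by
  unfold headState
  split_ifs
  · rw [put_of_ne _ _ hz]
  · rfl

/-- At the head of its loop a coordinating thread either has a complete team, or it has no team
at all. -/
theorem headState_spec {s : State m τ} {i : Thread m} (h : Inv s) (hc : (s i).coord = i)
    (hr : (s i).run = none) (ht : HasTask (s i)) :
    (∃ k, (s i).lev = 0 ∧ k ≤ (s i).team ∧ (s i).queue k ≠ [] ∧ (s i).req = (s i).team ∧
      headState i s i = { s i with team := k, req := k, acq := block i k }) ∨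
    ((s i).team < (s i).req ∧ 0 < (s i).team ∧
      headState i s i = { s i with team := 0, acq := {i} }) ∨
    ((s i).team = 0 ∧ 0 < (s i).req ∧ headState i s i = s i) := by
  unfold headState
  split_ifs with hl
  · rw [put_self]
    rcases (h.loc i).settle_spec hc ht with ⟨k, h1⟩ | h1 | h1
    · exact Or.inl ⟨k, hl, h1⟩
    · exact Or.inr (Or.inl h1)
    · exact Or.inr (Or.inr h1)
  · obtain ⟨h1, h2⟩ := (h.loc i).polling hc hr hl
    exact Or.inr (Or.inr ⟨h1, h2 ht, rfl⟩)

theorem headState_of_not {s : State m τ} {i : Thread m} (h : Inv s) (hc : (s i).coord = i)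
    (hr : (s i).run = none) (ht : ¬ HasTask (s i)) :
    headState i s i = { s i with team := 0, req := 0, acq := {i} } := by
  unfold headState
  split_ifs with hl
  · rw [put_self, LocalInv.settle_of_not ht]
  · obtain ⟨h1, -⟩ := (h.loc i).polling hc hr hl
    rw [← LocalInv.settle_of_not ht, (h.loc i).settle_eq_self hc h1]

/-- A coordinator with an incomplete team polls without a team and with its old requirement. -/
theorem headState_incomplete {s : State m τ} {i : Thread m} (h : Inv s) (hc : (s i).coord = i)
    (hr : (s i).run = none) (ht : HasTask (s i)) (hcomp : ¬ Complete i (headState i s)) :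
    0 < (s i).req ∧ (s i).team < (s i).req ∧ ∃ a, a ⊆ (s i).acq ∧ i ∈ a ∧
      headState i s i = { s i with team := 0, acq := a } := by
  rcases headState_spec h hc hr ht with ⟨k, hl, hk, hq, hr, he⟩ | ⟨hlt, h0, he⟩ | ⟨h0, hp, he⟩
  · exact absurd (by simp [Complete, he, hl, card_block]) hcomp
  · exact ⟨h0.trans hlt, hlt, _, by simpa using (h.loc i).mem_acq, by simp, he⟩
  · refine ⟨hp, by rwa [h0], _, Finset.Subset.rfl, (h.loc i).mem_acq, ?_⟩
    rw [he, ← h0]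

theorem canPoll_coordinate {s : State m τ} {i : Thread m} (h : Inv s) (hr : (s i).run = none)
    (hc : (s i).coord = i) (hp : (s i).pend = ∅) (ht : HasTask (s i))
    (hcomp : ¬ Complete i (headState i s)) : CanPoll i (headState i s) := by
  obtain ⟨h0, -, a, -, ha, he⟩ := headState_incomplete h hc hr ht hcomp
  exact
    { inv := h.headState hc hp
      pend := by rw [he]; exact hp
      run := by rw [he]; exact hr
      team := fun _ => by rw [he]
      req_pos := fun _ _ => by rw [he]; exact h0
      mem := by simp [he, hc, ha]
      free := fun h' => absurd (by rw [he]; exact hc) h' }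

theorem canPoll_idle {s : State m τ} {i : Thread m} (h : Inv s) (hr : (s i).run = none)
    (hc : (s i).coord = i) (hp : (s i).pend = ∅) (ht : ¬ HasTask (s i)) :
    CanPoll i (headState i s) := by
  have he := headState_of_not h hc hr ht
  exact
    { inv := h.headState hc hp
      pend := by rw [he]; exact hp
      run := by rw [he]; exact hr
      team := fun _ => by rw [he]
      req_pos := fun _ ht' => by rw [he] at ht'; exact absurd ht' ht
      mem := by simp [he, hc]
      free := fun h' => absurd (by rw [he]; exact hc) h' }

theorem canPoll_member {s : State m τ} {i : Thread m} (h : Inv s) (hr : (s i).run = none)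
    (hc : (s i).coord ≠ i) (ha : i ∈ (s (s i).coord).acq)
    (ht : ¬ SameTeam (s i).coord i (s (s i).coord).team) : CanPoll i s where
  inv := h
  pend := ((h.loc i).inactive hc).2.2
  run := hr
  team h' := absurd h' hc
  req_pos h' := absurd h' hc
  mem := ha
  free _ := ht

/-- A polling thread belongs to no foreign team: membership would make that thread its coordinator
and contradict `free`. It may thus be erased from any other list without damaging a team. -/
theorem CanPoll.block_subset {i z : Thread m} {s : State m τ} (h : CanPoll i s) (hz : z ≠ i) :
    block z (s z).team ⊆ (s z).acq.erase i := by
  intro y hy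
  have hy' := (h.inv.loc z).team_sub hy
  refine Finset.mem_erase.2 ⟨?_, hy'⟩
  rintro rfl
  have hcz := h.inv.coord_eq y z hy' hz.symm
  have := h.free (by rw [hcz]; exact hz)
  rw [hcz] at this
  exact this (mem_block.1 hy)

theorem Outcome.inv {i : Thread m} {s s' : State m τ} (h : CanPoll i s) (ho : Outcome i s s') :
    Inv s' := by
  have hi := h.inv.loc i
  cases ho with
  | lev ℓ =>
    refine h.inv.put ?_ Finset.Subset.rfl (fun w hw hm => h.inv.coord_eq i w hm hw.symm)
    exact
      { inactive := hi.inactive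
        req_eq := hi.req_eq
        team_sub := hi.team_sub
        acq_sub := hi.acq_sub
        pend_team := hi.pend_team
        ready := hi.ready
        polling := fun hc _ _ => ⟨h.team hc, h.req_pos hc⟩ }
  | move w hwi hwc hr hb ht =>
    have hcw := (h.inv.loc w).coord_of_req hr
    constructor
    · intro z
      by_cases hz : z = i
      · subst hz
        simp only [moved, if_true]
        exact
          { inactive := fun _ => ⟨rfl, rfl, h.pend⟩
            req_eq := fun h' => absurd h' hwi
            team_sub := by rw [block_zero]
            acq_sub := by rw [block_zero]
            pend_team := by simp [h.pend]
            ready := hi.ready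
            polling := fun h' => absurd h' hwi }
      · simp only [moved, hz, if_false]
        refine (h.inv.loc z).update (fun _ => Iff.rfl) ?_ ?_ Finset.Subset.rfl
        · split_ifs
          · exact (h.inv.loc z).team_sub.trans (Finset.subset_insert _ _)
          · exact h.block_subset hz
        · split_ifs with hzw
          · subst hzw
            exact Finset.insert_subset (mem_block.2 ht) (h.inv.loc z).acq_sub
          · exact (Finset.erase_subset _ _).trans (h.inv.loc z).acq_sub
    · intro z v hz hzv
      by_cases hzi : z = i
      · subst hzi
        simp only [moved, hzv.symm, if_false, if_true] at hz ⊢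
        by_contra hvw
        rw [if_neg (Ne.symm hvw)] at hz
        simp at hz
      · simp only [moved, hzi, if_false] at hz ⊢
        by_cases hvi : v = i
        · simp only [hvi, if_true, Finset.mem_singleton] at hz
          exact absurd hz hzi
        · simp only [hvi, if_false] at hz
          apply h.inv.coord_eq z v _ hzv
          split_ifs at hz
          · exact (Finset.mem_insert.1 hz).resolve_left hzi
          · exact Finset.mem_of_mem_erase hz
  | rob x j n l hx hn hl hj =>
    constructor
    · intro z
      by_cases hz : z = i
      · subst hz
        simp only [robbed, if_true]
        exact LocalInv.refresh rfl hi.team_sub hi.acq_sub hi.pend_team hi.ready (fun _ => rfl)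
      · simp only [robbed, hz, if_false]
        refine (h.inv.loc z).update ?_ (h.block_subset hz)
          ((Finset.erase_subset _ _).trans (h.inv.loc z).acq_sub) Finset.Subset.rfl
        intro j'
        split_ifs
        · by_cases hj' : j' = j
          · subst hj'
            simp [hn.ne']
          · simp [hj']
        · rfl
    · intro z v hz hzv
      by_cases hzi : z = i
      · subst hzi
        simp [robbed, hzv.symm] at hz
      · simp only [robbed, hzi, if_false] at hz ⊢
        by_cases hvi : v = i
        · subst hvi
          simp only [if_true] at hz
          have hsub := LocalInv.refresh_acq_subset (i := v) (L :=
            { s v with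
              coord := v
              queue := Function.update (s v).queue j (l ++ (s v).queue j)
              lev := 0 }) hi.team_sub
          exact h.inv.coord_eq z v (hsub hz) hzv
        · simp only [hvi, if_false] at hz
          exact h.inv.coord_eq z v (Finset.mem_of_mem_erase hz) hzv

theorem Inv.launch {s : State m τ} {i : Thread m} (h : Inv s) (hc : (s i).coord = i)
    (hcomp : Complete i s) (t : τ) (rest : List τ) : Inv (launch i t rest s) := by
  have hi := h.loc i
  have ha := hi.acq_eq_block hcomp.2
  refine h.put (LocalInv.refresh hc ?_ ?_ ?_ ?_ ?_) (LocalInv.refresh_acq_subset ?_) ?_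
  · exact ha.ge
  · exact ha.le
  · intro z hz
    have hz' := Finset.mem_erase.1 hz
    exact ⟨hz'.1, mem_block.1 (ha ▸ hz'.2)⟩
  · simp
  · simp
  · exact ha.ge
  · intro w hw hm
    exact h.coord_eq i w hm hw.symm

theorem Step.inv {lv : τ → Level m} {i : Thread m} {s s' : State m τ} (h : Inv s)
    (hs : Step lv i s s') : Inv s' := by
  have hi := h.loc i
  have hco : ∀ w, w ≠ i → i ∈ (s w).acq → (s i).coord = w :=
    fun w hw hm => h.coord_eq i w hm hw.symm
  cases hs with
  | work => exact h
  | teamed => exact h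
  | wait => exact h
  | spawn t hr L hL =>
    subst hL
    split_ifs with hc
    · refine h.put (LocalInv.refresh hc hi.team_sub hi.acq_sub hi.pend_team hi.ready ?_)
        (LocalInv.refresh_acq_subset hi.team_sub) hco
      exact fun h' => absurd h' hr
    · refine h.put ?_ Finset.Subset.rfl hco
      exact
        { inactive := hi.inactive
          req_eq := fun h' => absurd h' hc
          team_sub := hi.team_sub
          acq_sub := hi.acq_sub
          pend_team := hi.pend_team
          ready := hi.ready
          polling := fun h' => absurd h' hc }
  | finish hr =>
    refine h.put ?_ Finset.Subset.rfl hco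
    exact
      { inactive := hi.inactive
        req_eq := hi.req_eq
        team_sub := hi.team_sub
        acq_sub := hi.acq_sub
        pend_team := hi.pend_team
        ready := hi.ready
        polling := fun _ _ h' => absurd rfl h' }
  | start c hr hc hne hm s₁ hs₁ =>
    have h1 : Inv s₁ := by
      subst hs₁
      refine h.put ?_ Finset.Subset.rfl (fun w hw hm => h.coord_eq c w hm hw.symm)
      exact (h.loc c).update (fun _ => Iff.rfl) (h.loc c).team_sub (h.loc c).acq_sub
        (Finset.erase_subset _ _)
    have hi1 := h1.loc i
    refine h1.put ?_ Finset.Subset.rfl (fun w hw hm => h1.coord_eq i w hm hw.symm)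
    exact
      { inactive := hi1.inactive
        req_eq := hi1.req_eq
        team_sub := hi1.team_sub
        acq_sub := hi1.acq_sub
        pend_team := hi1.pend_team
        ready := hi1.ready
        polling := fun _ _ h' => absurd rfl h' }
  | revoked c hr hc hne hp ha =>
    refine h.put (LocalInv.refresh rfl hi.team_sub hi.acq_sub hi.pend_team hi.ready
      (fun _ => rfl)) (LocalInv.refresh_acq_subset hi.team_sub) ?_
    intro w hw hm
    -- A thread listing `i` would be its coordinator `c`, which has just been seen not to list it.
    have := hco w hw hm
    rw [hc, this] at ha
    exact absurd hm ha
  | member c hr hc hne hp ha ht s' hs' =>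
    subst hc
    have hcp := canPoll_member h hr hne ha ht
    exact (hs'.outcome hcp).inv hcp
  | idle hr hc hp ht s' hs' =>
    have hcp := canPoll_idle h hr hc hp ht
    have he := headState_of_not h hc hr ht
    exact (hs'.outcome hcp (by rw [he]; exact hc) (by rw [he]; exact ht)).inv hcp
  | launch hr hc hp ht hcomp t rest hq =>
    refine (h.headState hc hp).launch ?_ hcomp t rest
    rcases headState_spec h hc hr ht with ⟨k, -, -, -, -, he⟩ | ⟨-, -, he⟩ | ⟨-, -, he⟩ <;>
    · rw [he]
      exact hc
  | coordinate hr hc hp ht hcomp s' hs' =>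
    have hcp := canPoll_coordinate h hr hc hp ht hcomp
    exact (hs'.outcome hcp).inv hcp

theorem IsInitial.inv {lv : τ → Level m} {s : State m τ} (h : IsInitial lv s) : Inv s := by
  obtain ⟨q, -, hq⟩ := h
  constructor
  · intro i
    rw [hq i]
    exact LocalInv.refresh rfl (by simp [block_zero]) (by simp [block_zero]) (by simp) (by simp)
      (fun _ => rfl)
  · intro z w hz hzw
    rw [hq w] at hz
    have := LocalInv.refresh_acq_subset (by simp [block_zero]) hz
    simp at this
    exact absurd this hzw

theorem IsRun.inv {lv : τ → Level m} {s : ℕ → State m τ} {σ : ℕ → Thread m} (h : IsRun lv s σ)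
    (n : ℕ) : Inv (s n) := by
  induction n with
  | zero => exact h.1.inv
  | succ n ih => exact (h.2 n).inv ih

/-! ### The effect of a step on the other threads -/

/-- What a step of thread `i` may change in the data of another thread. -/
structure Undisturbed (i : Thread m) (L L' : Local m τ) : Prop where
  coord : L'.coord = L.coord
  req : L'.req = L.req
  team : L'.team = L.team
  run : L'.run = L.run
  lev : L'.lev = L.lev
  queue : ∀ j, L'.queue j = [] ↔ L.queue j = []
  pend_subset : L'.pend ⊆ L.pend
  mem_pend : ∀ y, y ≠ i → y ∈ L.pend → y ∈ L'.pend
  mem_acq : ∀ y, y ≠ i → (y ∈ L'.acq ↔ y ∈ L.acq)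

theorem Undisturbed.rfl {i : Thread m} {L : Local m τ} : Undisturbed i L L := by
  constructor <;> simp

theorem Outcome.undisturbed {i z : Thread m} {s s' : State m τ} (ho : Outcome i s s')
    (hz : z ≠ i) : Undisturbed i (s z) (s' z) := by
  cases ho with
  | lev ℓ =>
    rw [setLev_of_ne _ _ hz]
    exact .rfl
  | move w hwi hwc hr hb ht =>
    simp only [moved, hz, if_false]
    constructor <;> try simp
    intro y hy
    split_ifs <;> simp [hy]
  | rob x j n l hx hn hl hj =>
    simp only [robbed, hz, if_false]
    constructor <;> try simp
    · intro j'
      split_ifs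
      · by_cases hj' : j' = j
        · subst hj'
          simp [hn.ne']
        · simp [hj']
      · rfl
    · intro y hy _
      exact hy

theorem Step.undisturbed {lv : τ → Level m} {i z : Thread m} {s s' : State m τ} (h : Inv s)
    (hs : Step lv i s s') (hz : z ≠ i) : Undisturbed i (s z) (s' z) := by
  cases hs with
  | work => exact .rfl
  | teamed => exact .rfl
  | wait => exact .rfl
  | spawn t hr L hL =>
    rw [put_of_ne _ _ hz]
    exact .rfl
  | finish hr =>
    rw [put_of_ne _ _ hz]
    exact .rfl
  | start c hr hc hne hm s₁ hs₁ =>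
    rw [put_of_ne _ _ hz, hs₁]
    by_cases hzc : z = c
    · subst hzc
      rw [put_self]
      constructor <;> simp_all
      exact Finset.erase_subset _ _
    · rw [put_of_ne _ _ hzc]
      exact .rfl
  | revoked c hr hc hne hp ha =>
    rw [put_of_ne _ _ hz]
    exact .rfl
  | member c hr hc hne hp ha ht s' hs' =>
    subst hc
    exact (hs'.outcome (canPoll_member h hr hne ha ht)).undisturbed hz
  | idle hr hc hp ht s' hs' =>
    have he := headState_of_not h hc hr ht
    rw [← headState_of_ne (s := s) hz]
    exact (hs'.outcome (canPoll_idle h hr hc hp ht) (by rw [he]; exact hc)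
      (by rw [he]; exact ht)).undisturbed hz
  | launch hr hc hp ht hcomp t rest hq =>
    unfold TeamBuilding.launch
    rw [put_of_ne _ _ hz, headState_of_ne hz]
    exact .rfl
  | coordinate hr hc hp ht hcomp s' hs' =>
    rw [← headState_of_ne (s := s) hz]
    exact (hs'.outcome (canPoll_coordinate h hr hc hp ht hcomp)).undisturbed hz

theorem Undisturbed.coordinating {i z : Thread m} {s s' : State m τ}
    (h : Undisturbed i (s z) (s' z)) (hc : Coordinating s z) : Coordinating s' z := by
  refine ⟨h.coord.trans hc.1, h.run.trans hc.2.1, ?_, (hasTask_congr h.queue).2 hc.2.2.2⟩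
  exact Finset.subset_empty.1 (hc.2.2.1 ▸ h.pend_subset)

/-! ### Steps of coordinating threads -/

theorem Coordinating.step {lv : τ → Level m} {y : Thread m} {s s' : State m τ}
    (hy : Coordinating s y) (hs : Step lv y s s') :
    (Complete y (headState y s) ∧ ∃ t rest, (headState y s y).queue (headState y s y).req =
      t :: rest ∧ s' = launch y t rest (headState y s)) ∨
    (¬ Complete y (headState y s) ∧ Poll y (headState y s) s') := by
  obtain ⟨h1, h2, h3, h4⟩ := hy
  cases hs with
  | work h => exact absurd h2 h
  | spawn t h => exact absurd h2 h
  | finish h => exact absurd h2 h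
  | start c _ hc hne => exact absurd h1 (hc ▸ hne)
  | revoked c _ hc hne => exact absurd h1 (hc ▸ hne)
  | teamed c _ hc hne => exact absurd h1 (hc ▸ hne)
  | member c _ hc hne => exact absurd h1 (hc ▸ hne)
  | wait _ _ h => exact absurd h3 h
  | idle _ _ _ h => exact absurd h4 h
  | launch _ _ _ _ hcomp t rest hq => exact Or.inl ⟨hcomp, t, rest, hq, rfl⟩
  | coordinate _ _ _ _ hcomp _ hs' => exact Or.inr ⟨hcomp, hs'⟩

theorem headState_queue {s : State m τ} {i : Thread m} :
    (headState i s i).queue = (s i).queue := by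
  unfold headState
  split_ifs
  · rw [put_self]
    unfold settle
    dsimp only
    split_ifs <;> rfl
  · rfl

/-- The new requirement of a polling thread that has stolen tasks. -/
theorem robbed_req {i x : Thread m} {j : Level m} {n : ℕ} {l : List τ} {s : State m τ}
    (h : Inv s) (hc : (s i).coord = i) (h0 : (s i).team = 0) (hl : l ≠ [])
    (hj : j < (s i).req) : (robbed i x j n l s i).req = j := by
  have hreq := (h.loc i).req_eq hc
  rw [h0, max_eq_right (Fin.zero_le _)] at hreq
  simp only [robbed, if_true, refresh]
  rw [h0, max_eq_right (Fin.zero_le _)]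
  apply le_antisymm
  · apply smallest_le
    simp [hl]
  · rcases smallest_cases 0 (Function.update (s i).queue j (l ++ (s i).queue j)) with h1 | h1
    · exact absurd (h1.1 j) (by simp [hl])
    · by_contra hlt
      -- A smaller nonempty queue would be untouched by the theft, so it would have bounded the old
      -- requirement from below `j` already.
      have hlt' := not_le.1 hlt
      rw [Function.update_of_ne hlt'.ne] at h1
      have h2 := smallest_le (d := 0) h1.1
      rw [← hreq] at h2
      exact absurd (h2.trans_lt hlt') (not_lt.2 hj.le)

/-- A launch lengthens no queue, and neither does a change of level or of coordinator, so growth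
means a theft during polling. Polling happens below the current requirement and without a team, so
the stolen size becomes the new requirement. -/
theorem Coordinating.stolen {lv : τ → Level m} {y : Thread m} {s s' : State m τ} (h : Inv s)
    (hy : Coordinating s y) (hs : Step lv y s s') (j : Level m)
    (hj : ((s y).queue j).length < ((s' y).queue j).length) :
    j < (s y).req ∧ (s' y).req = j ∧ Coordinating s' y := by
  rcases hy.step hs with ⟨-, t, rest, hq, rfl⟩ | ⟨hcomp, hp⟩
  · exfalso
    simp only [launch, put_self, refresh] at hj
    rw [headState_queue] at hj hq
    by_cases hjr : j = (headState y s y).req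
    · rw [← hjr] at hq
      rw [← hjr, Function.update_self, hq] at hj
      simp at hj
    · rw [Function.update_of_ne hjr] at hj
      exact lt_irrefl _ hj
  · obtain ⟨h1, h2, h3, h4⟩ := hy
    have hcp := canPoll_coordinate h h2 h1 h3 h4 hcomp
    obtain ⟨-, -, a, -, -, he⟩ := headState_incomplete h h1 h2 h4 hcomp
    have hqe := headState_queue (i := y) (s := s)
    have ho := hp.outcome hcp
    cases ho with
    | lev ℓ =>
      rw [setLev_self] at hj
      exact absurd hj (by rw [hqe]; exact lt_irrefl _)
    | move w =>
      simp only [moved, if_true] at hj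
      exact absurd hj (by rw [hqe]; exact lt_irrefl _)
    | rob x j' n l hx hn hl hj' =>
      have hc' : (headState y s y).coord = y := by rw [he]; exact h1
      have hj'' := hj' (Or.inl (by rw [he]; exact h4))
      rw [hc'] at hj''
      have hjj : j = j' := by
        by_contra hne
        simp only [robbed, if_true, refresh, Function.update_of_ne hne] at hj
        exact absurd hj (by rw [hqe]; exact lt_irrefl _)
      subst hjj
      refine ⟨by rwa [he] at hj'', robbed_req hcp.inv hc' (hcp.team hc') hl hj'', ?_⟩
      simp only [Coordinating, robbed, if_true, refresh]
      refine ⟨trivial, hcp.run, hcp.pend, j, ?_⟩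
      simp [hl]

/-! ### Conflicts -/

namespace Conflict

variable {s : State m τ} {x y : Thread m}

theorem symm (h : Conflict s x y) : Conflict s y x :=
  ⟨h.1.symm, h.2.2.1, h.2.1, h.2.2.2.2, h.2.2.2.1⟩

theorem not_mem_acq (hi : Inv s) (h : Conflict s x y) : y ∉ (s x).acq := fun hm =>
  h.1 ((hi.coord_eq y x hm h.1.symm).symm.trans h.2.2.1.1)

/-- A thread that is in conflict with another one cannot have a complete team. -/
theorem not_complete (hi : Inv s) (h : Conflict s x y) : ¬ Complete x (headState x s) := by
  rintro ⟨-, hcard⟩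
  obtain ⟨h1, h2, h3, h4⟩ := h.2.1
  -- If the old team meets the requirement, it already contains `y`; a disbanded team has one member
  -- although more are required; without a team, a full list is the whole block and contains `y`.
  rcases headState_spec hi h1 h2 h4 with ⟨k, -, -, -, hr, -⟩ | ⟨hlt, -, he⟩ | ⟨-, -, he⟩
  · refine h.not_mem_acq hi ((hi.loc x).team_sub (mem_block.2 ?_))
    rw [← hr]
    exact h.2.2.2.1
  · rw [he] at hcard
    have h0 : (0 : ℕ) < (s x).req := lt_of_le_of_lt (Nat.zero_le _) (Fin.lt_def.1 hlt)
    have := Nat.one_lt_two_pow h0.ne'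
    simp only [Finset.card_singleton] at hcard
    omega
  · rw [he] at hcard
    refine h.not_mem_acq hi ?_
    rw [(hi.loc x).acq_eq_block hcard]
    exact mem_block.2 h.2.2.2.1

theorem poll {lv : τ → Level m} {s' : State m τ} (hi : Inv s) (h : Conflict s x y)
    (hs : Step lv x s s') : CanPoll x (headState x s) ∧ Poll x (headState x s) s' ∧
      ∃ a, headState x s x = { s x with team := 0, acq := a } := by
  rcases h.2.1.step hs with ⟨h', -⟩ | ⟨h', hp⟩
  · exact absurd h' (h.not_complete hi)
  · obtain ⟨h1, h2, h3, h4⟩ := h.2.1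
    obtain ⟨-, -, a, -, -, he⟩ := headState_incomplete hi h1 h2 h4 h'
    exact ⟨canPoll_coordinate hi h2 h1 h3 h4 h', hp, a, he⟩

theorem xor_beats (h : Conflict s x y) : Xor (Beats s x y) (Beats s y x) := by
  unfold Beats Xor
  rcases lt_trichotomy (s x).req (s y).req with h1 | h1 | h1
  · left
    exact ⟨Or.inl h1, by simp [h1.ne', h1.le]⟩
  · rcases lt_or_gt_of_ne h.1 with h2 | h2
    · left
      exact ⟨Or.inr ⟨h1, h2⟩, by simp [h1, h2.le]⟩
    · right
      exact ⟨Or.inr ⟨h1.symm, h2⟩, by simp [h1, h2.le]⟩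
  · right
    exact ⟨Or.inl h1, by simp [h1.ne', h1.le]⟩

end Conflict

theorem Beats.not_req_lt {s : State m τ} {x y : Thread m} (h : Beats s x y) :
    ¬ (s y).req < (s x).req := by
  rcases h with h | h
  · exact not_lt.2 h.le
  · exact h.1.symm ▸ lt_irrefl _

theorem Beats.not_req_eq {s : State m τ} {x y : Thread m} (h : Beats s x y) :
    ¬ ((s y).req = (s x).req ∧ y < x) := by
  rintro ⟨h1, h2⟩
  rcases h with h | h
  · exact h.ne h1.symm
  · exact lt_asymm h2 h.2

/-- A polling thread that encounters an active follower of a winning coordinator that requires it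
switches to this coordinator. -/
theorem Poll.follows_winner {i x : Thread m} {s s' : State m τ} (h : CanPoll i s)
    (hp : Poll i s s') (hf : Follows s (partner i (s i).lev) x) (hne : x ≠ (s i).coord)
    (hb : Beats s x (s i).coord) (ht : SameTeam x i (s x).req) : Follows s' i x := by
  -- Thread `i` and its partner both lie in the required block of `x`, so the flipped bit is below
  -- the block's exponent. At levels `≥ m` the partner would be `i` itself, whose coordinator is not
  -- `x`.
  have hlev : (s i).lev < ((s x).req : ℕ) := by
    by_contra hle
    have h1 : SameTeam i (partner i (s i).lev) (s x).req :=
      ht.symm.trans (mem_block.1 ((h.inv.loc x).acq_sub hf.2))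
    by_cases hm : (s i).lev < m
    · exact not_sameTeam_partner i (not_lt.1 hle) hm h1
    · have := hf.1
      rw [partner_of_le _ (not_lt.1 hm)] at this
      exact hne this.symm
  have hle : ((s x).req : ℕ) ≤ ((s (s i).coord).req : ℕ) := not_lt.1 hb.not_req_lt
  cases hp with
  | done hd => omega
  | skip c p w ℓ hc hℓ hx hw hlt h' =>
    subst hc hℓ hx
    rw [hf.1] at hw
    subst hw
    rcases h' with h' | h' | h'
    · exact absurd h' hne
    · exact absurd h' hb.not_req_lt
    · exact absurd ⟨h'.1.symm, h'.2⟩ hb.not_req_eq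
  | switch c p w ℓ hc hℓ hx hw hlt hne' h' =>
    subst hc hℓ hx
    rw [hf.1] at hw
    subst hw
    have hwi := h.ne_of_req_pos (Fin.lt_def.2 (lt_of_le_of_lt (Nat.zero_le _) hlev)) hne
    rw [h.inv.switchTo_eq hwi hne, if_pos ht]
    simp [Follows, moved, hwi]
  | help c p w ℓ j hc hℓ hx hw hlt hne' h' hℓw hj hq =>
    subst hc hℓ hx
    rw [hf.1] at hw
    subst hw
    omega
  | nothing c p w ℓ hc hℓ hx hw hlt hne' h' hℓw hq =>
    subst hc hℓ hx
    rw [hf.1] at hw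
    subst hw
    omega

/-- A polling thread that encounters a follower of a losing coordinator does nothing. -/
theorem Poll.stays {i y : Thread m} {s s' : State m τ}
    (hp : Poll i s s') (hf : (s (partner i (s i).lev)).coord = y)
    (hb : Beats s (s i).coord y) : ∃ ℓ, s' = setLev i ℓ s := by
  cases hp with
  | done hd => exact ⟨_, rfl⟩
  | skip => exact ⟨_, rfl⟩
  | nothing => exact ⟨_, rfl⟩
  | switch c p w ℓ hc hℓ hx hw hlt hne' h' =>
    subst hc hℓ hx
    rw [hf] at hw
    subst hw
    rcases h' with h' | h'
    · exact absurd h' hb.not_req_eq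
    · exact absurd h'.1 hb.not_req_lt
  | help c p w ℓ j hc hℓ hx hw hlt hne' h' hℓw hj hq =>
    subst hc hℓ hx
    rw [hf] at hw
    subst hw
    exact absurd h' hb.not_req_lt

theorem follows_setLev {s : State m τ} {i z w : Thread m} {ℓ : ℕ} (h : Follows s z w) :
    Follows (setLev i ℓ s) z w := by
  unfold Follows setLev at *
  have h1 : ∀ v, (put s i { s i with lev := ℓ } v).coord = (s v).coord := by
    intro v
    by_cases hv : v = i
    · subst hv
      rw [put_self]
    · rw [put_of_ne _ _ hv]
  have h2 : ∀ v, (put s i { s i with lev := ℓ } v).acq = (s v).acq := by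
    intro v
    by_cases hv : v = i
    · subst hv
      rw [put_self]
    · rw [put_of_ne _ _ hv]
  rwa [h1, h2]

namespace Conflict

variable {lv : τ → Level m} {s s' : State m τ} {x y i : Thread m}

/-- If `i = y`, the conflict itself forces polling. Otherwise `start` is excluded since `y` has
nobody pending, `revoked` by the active registration and `teamed` by the freedom to switch; polling
remains and `Poll.follows_winner` applies. -/
theorem switches (hi : Inv s) (h : Conflict s x y) (hb : Beats s x y) (hs : Step lv i s s')
    (hf : Follows s i y) (hfree : FreeToSwitch s i y) (ht : SameTeam x i (s x).req)
    (hp : Follows s (partner i (s i).lev) x) : Follows s' i x := by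
  by_cases hiy : i = y
  · subst hiy
    obtain ⟨hcp, hpoll, a, he⟩ := h.symm.poll hi hs
    have hx : headState i s x = s x := headState_of_ne h.1
    have hlev : (headState i s i).lev = (s i).lev := by rw [he]
    have hco : (headState i s i).coord = i := by rw [he]; exact hf.1
    have hpi : partner i (s i).lev ≠ i := by
      intro h'
      rw [h'] at hp
      exact h.1 (hp.1.symm.trans hf.1)
    apply hpoll.follows_winner hcp
    · rw [hlev]
      unfold Follows
      rw [headState_of_ne hpi, hx]
      exact hp
    · rw [hco]
      exact h.1
    · rw [hco]
      unfold Beats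
      rw [hx, he]
      exact hb
    · rwa [hx]
  · obtain ⟨hrun, hteam⟩ := hfree.resolve_left hiy
    have hpoll : CanPoll i s ∧ Poll i s s' := by
      have hpe := h.2.2.1.2.2.1
      cases hs with
      | work h' => exact absurd hrun h'
      | spawn t h' => exact absurd hrun h'
      | finish h' => exact absurd hrun h'
      | start c _ hc hne hm =>
        rw [hc, hf.1, hpe] at hm
        exact absurd hm (Finset.notMem_empty _)
      | revoked c _ hc hne _ hm =>
        rw [hc, hf.1] at hm
        exact absurd hf.2 hm
      | teamed c _ hc hne _ _ h' =>
        rw [hc, hf.1] at h'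
        exact absurd h' hteam
      | member c _ hc hne _ hm h' _ hs' =>
        subst hc
        exact ⟨canPoll_member hi hrun hne hm h', hs'⟩
      | wait _ hc => exact absurd (hc.symm.trans hf.1) hiy
      | idle _ hc => exact absurd (hc.symm.trans hf.1) hiy
      | launch _ hc => exact absurd (hc.symm.trans hf.1) hiy
      | coordinate _ hc => exact absurd (hc.symm.trans hf.1) hiy
    refine hpoll.2.follows_winner hpoll.1 hp ?_ ?_ ht
    · rw [hf.1]
      exact h.1
    · rwa [hf.1]

theorem stays (hi : Inv s) (h : Conflict s x y) (hb : Beats s x y) (hs : Step lv i s s')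
    (hf : Follows s i x) (hp : Follows s (partner i (s i).lev) y) : Follows s' i x := by
  by_cases hix : i = x
  · subst hix
    obtain ⟨hcp, hpoll, a, he⟩ := h.poll hi hs
    have hy : headState i s y = s y := headState_of_ne h.1.symm
    have hlev : (headState i s i).lev = (s i).lev := by rw [he]
    have hco : (headState i s i).coord = i := by rw [he]; exact hf.1
    have hpi : partner i (s i).lev ≠ i := by
      intro h'
      rw [h'] at hp
      exact h.1 (hf.1.symm.trans hp.1)
    obtain ⟨ℓ, rfl⟩ := hpoll.stays (y := y)
      (by rw [hlev, headState_of_ne hpi]; exact hp.1)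
      (by
        rw [hco]
        unfold Beats
        rw [hy, he]
        exact hb)
    refine follows_setLev ⟨hco, ?_⟩
    have := hcp.mem
    rwa [hco] at this
  · have hpe := h.2.1.2.2.1
    have hne' : x ≠ i := Ne.symm hix
    cases hs with
    | work => exact hf
    | teamed => exact hf
    | spawn t h' L hL =>
      have hc : (s i).coord ≠ i := by rw [hf.1]; exact hne'
      rw [if_neg hc]
      subst hL
      exact ⟨by rw [put_self]; exact hf.1, by rw [put_of_ne _ _ hne']; exact hf.2⟩
    | finish h' =>
      exact ⟨by rw [put_self]; exact hf.1, by rw [put_of_ne _ _ hne']; exact hf.2⟩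
    | start c _ hc hne hm =>
      rw [hc, hf.1, hpe] at hm
      exact absurd hm (Finset.notMem_empty _)
    | revoked c _ hc hne _ hm =>
      rw [hc, hf.1] at hm
      exact absurd hf.2 hm
    | member c _ hc hne _ hm h' _ hs' =>
      obtain ⟨ℓ, rfl⟩ := hs'.stays hp.1 (by rwa [hf.1])
      exact follows_setLev hf
    | wait _ hc => exact absurd (hc.symm.trans hf.1) hix
    | idle _ hc => exact absurd (hc.symm.trans hf.1) hix
    | launch _ hc => exact absurd (hc.symm.trans hf.1) hix
    | coordinate _ hc => exact absurd (hc.symm.trans hf.1) hix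

/-- A step of one of the two threads in conflict preserves the conflict or resolves it. -/
theorem own_step (hi : Inv s) (h : Conflict s x y) (hs : Step lv x s s') :
    Conflict s' x y ∨ Yields s s' x y := by
  obtain ⟨hcp, hpoll, a, he⟩ := h.poll hi hs
  have hu := hs.undisturbed hi h.1.symm
  have hy := hu.coordinating h.2.2.1
  have hco : (headState x s x).coord = x := by rw [he]; exact h.2.1.1
  have ho := hpoll.outcome hcp
  cases ho with
  | lev ℓ =>
    left
    refine ⟨h.1, ?_, hy, ?_, ?_⟩
    · unfold Coordinating
      rw [setLev_self, he]
      exact h.2.1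
    · rw [setLev_self, he]
      exact h.2.2.2.1
    · rw [hu.req]
      exact h.2.2.2.2
  | move w hwi hwc hr hb ht =>
    right
    refine ⟨hy, hu.req, Or.inl ⟨w, hwi, ?_, ?_, ?_⟩⟩
    · have := hb (Or.inl (by rw [he]; exact h.2.1.2.2.2))
      unfold Beats at this ⊢
      rwa [hco, headState_of_ne hwi, he] at this
    · rwa [headState_of_ne hwi] at ht
    · simp [Follows, moved, hwi]
  | rob z j n l hz hn hl hj =>
    have hj' := hj (Or.inl (by rw [he]; exact h.2.1.2.2.2))
    rw [hco] at hj'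
    have hreq := robbed_req (x := z) (n := n) hcp.inv hco (hcp.team hco) hl hj'
    have hx : Coordinating (robbed x z j n l (headState x s)) x := by
      simp only [Coordinating, robbed, if_true, refresh]
      exact ⟨trivial, hcp.run, hcp.pend, j, by simp [hl]⟩
    -- A theft ends the conflict only if the smaller team no longer contains `y`.
    by_cases ht : SameTeam x y j
    · left
      refine ⟨h.1, hx, hy, by rwa [hreq], ?_⟩
      rw [hu.req]
      exact h.2.2.2.2
    · right
      refine ⟨hy, hu.req, Or.inr ⟨hx, ?_, by rwa [hreq]⟩⟩
      rw [hreq]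
      rwa [he] at hj'

theorem step (hi : Inv s) (h : Conflict s x y) (hs : Step lv i s s') :
    Conflict s' x y ∨ Yields s s' x y ∨ Yields s s' y x := by
  by_cases hx : i = x
  · subst hx
    rcases h.own_step hi hs with h' | h'
    · exact Or.inl h'
    · exact Or.inr (Or.inl h')
  by_cases hy : i = y
  · subst hy
    rcases h.symm.own_step hi hs with h' | h'
    · exact Or.inl h'.symm
    · exact Or.inr (Or.inr h')
  · left
    have hux := hs.undisturbed hi (Ne.symm hx)
    have huy := hs.undisturbed hi (Ne.symm hy)
    refine ⟨h.1, hux.coordinating h.2.1, huy.coordinating h.2.2.1, ?_, ?_⟩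
    · rw [hux.req]
      exact h.2.2.2.1
    · rw [huy.req]
      exact h.2.2.2.2

end Conflict

/-! ### Fair schedules -/

/-- The first step of `i` after time `k` is preceded by steps of other threads only, which carry `P`
along. -/
theorem Fair.exists_step {σ : ℕ → Thread m} (hf : Fair σ) (i : Thread m) {P : ℕ → Prop} {k : ℕ}
    (hP : ∀ n, k ≤ n → P n → σ n ≠ i → P (n + 1)) (hk : P k) : ∃ n, k ≤ n ∧ σ n = i ∧ P n := by
  classical
  have hex : ∃ n, k ≤ n ∧ σ n = i := hf i k
  obtain ⟨h1, h2⟩ := Nat.find_spec hex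
  refine ⟨Nat.find hex, h1, h2, ?_⟩
  have key : ∀ n, k ≤ n → n ≤ Nat.find hex → P n := by
    intro n hn
    induction n, hn using Nat.le_induction with
    | base => exact fun _ => hk
    | succ n hn ih =>
      intro hle
      refine hP n hn (ih (by omega)) fun hσ => ?_
      exact Nat.find_min hex (by omega) ⟨hn, hσ⟩
  exact key _ h1 le_rfl

theorem eventually_const_of_antitone {f : ℕ → ℕ} (h : ∀ᶠ k in atTop, f (k + 1) ≤ f k) :
    ∃ v, ∀ᶠ k in atTop, f k = v := by
  classical
  obtain ⟨N, hN⟩ := eventually_atTop.1 h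
  have hex : ∃ v, ∃ k, N ≤ k ∧ f k = v := ⟨_, N, le_rfl, rfl⟩
  obtain ⟨k, hk, hv⟩ := Nat.find_spec hex
  refine ⟨Nat.find hex, eventually_atTop.2 ⟨k, fun n hn => ?_⟩⟩
  have h1 : f n ≤ f k := by
    induction n, hn using Nat.le_induction with
    | base => exact le_rfl
    | succ n hn ih => exact (hN n (hk.trans hn)).trans ih
  exact le_antisymm (hv ▸ h1) (Nat.find_min' hex ⟨n, hk.trans hn, rfl⟩)

/-- Ranking-function principle: a natural number cannot drop at each of the infinitely many steps of
`i` while all other steps leave it fixed. -/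
theorem Fair.no_descent {σ : ℕ → Thread m} (hf : Fair σ) (i : Thread m) {f : ℕ → ℕ} {N : ℕ}
    (h1 : ∀ n, N ≤ n → σ n ≠ i → f (n + 1) = f n) (h2 : ∀ n, N ≤ n → σ n = i → f (n + 1) < f n) :
    False := by
  obtain ⟨v, hv⟩ := eventually_const_of_antitone (f := f) (eventually_atTop.2 ⟨N, fun n hn => by
    by_cases hσ : σ n = i
    · exact (h2 n hn hσ).le
    · exact (h1 n hn hσ).le⟩)
  obtain ⟨K, hK⟩ := eventually_atTop.1 hv
  obtain ⟨n, hn, hσ⟩ := hf i (max N K)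
  have h3 := h2 n ((le_max_left _ _).trans hn) hσ
  rw [hK n ((le_max_right _ _).trans hn), hK (n + 1) (by omega)] at h3
  exact lt_irrefl _ h3

/-! ### The end of a finite computation -/

/-- Nothing is running or published. -/
structure Calm (s : State m τ) : Prop where
  inv : Inv s
  run : ∀ i, (s i).run = none
  pend : ∀ i, (s i).pend = ∅

theorem Calm.step {lv : τ → Level m} {i : Thread m} {s s' : State m τ} (h : Calm s)
    (h' : Calm s') (hs : Step lv i s s') :
    ((s i).coord ≠ i ∧ i ∉ (s (s i).coord).acq ∧
      s' = put s i (refresh i { s i with coord := i, lev := 0 })) ∨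
    ((s i).coord ≠ i ∧ SameTeam (s i).coord i (s (s i).coord).team ∧ s' = s) ∨
    ((s i).coord ≠ i ∧ CanPoll i s ∧ Poll i s s') ∨
    ((s i).coord = i ∧ ¬ HasTask (s i) ∧ CanPoll i (headState i s) ∧
      Seek i (headState i s) s') ∨
    ((s i).coord = i ∧ HasTask (s i) ∧ ¬ Complete i (headState i s) ∧
      CanPoll i (headState i s) ∧ Poll i (headState i s) s') := by
  cases hs with
  | work h1 => exact absurd (h.run i) h1
  | spawn t h1 => exact absurd (h.run i) h1
  | finish h1 => exact absurd (h.run i) h1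
  | start c _ hc hne hm =>
    rw [h.pend c] at hm
    exact absurd hm (Finset.notMem_empty _)
  | revoked c _ hc hne _ hm =>
    subst hc
    exact Or.inl ⟨hne, hm, rfl⟩
  | teamed c _ hc hne _ _ ht =>
    subst hc
    exact Or.inr (Or.inl ⟨hne, ht, rfl⟩)
  | member c hr hc hne _ hm ht _ hs' =>
    subst hc
    exact Or.inr (Or.inr (Or.inl ⟨hne, canPoll_member h.inv hr hne hm ht, hs'⟩))
  | wait _ _ h1 => exact absurd (h.pend i) h1
  | idle hr hc hp ht _ hs' =>
    exact Or.inr (Or.inr (Or.inr (Or.inl ⟨hc, ht, canPoll_idle h.inv hr hc hp ht, hs'⟩)))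
  | launch hr hc hp ht hcomp t rest hq =>
    -- A launch would leave `i` running, which calmness of the next state forbids.
    have := h'.run i
    simp [TeamBuilding.launch, refresh] at this
  | coordinate hr hc hp ht hcomp _ hs' =>
    exact Or.inr (Or.inr (Or.inr (Or.inr
      ⟨hc, ht, hcomp, canPoll_coordinate h.inv hr hc hp ht hcomp, hs'⟩)))

theorem Outcome.team_self {i : Thread m} {s s' : State m τ} (h : CanPoll i s)
    (ho : Outcome i s s') : (s' i).team = 0 := by
  have h0 : (s i).team = 0 := by
    by_cases hc : (s i).coord = i
    · exact h.team hc
    · exact ((h.inv.loc i).inactive hc).2.1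
  cases ho with
  | lev ℓ => rwa [setLev_self]
  | move => simp [moved]
  | rob => simpa [robbed, refresh] using h0

theorem Outcome.queue_self {i : Thread m} {s s' : State m τ}
    (ho : Outcome i s s') (j : Level m) (hq : (s i).queue j ≠ []) : (s' i).queue j ≠ [] := by
  cases ho with
  | lev ℓ => rwa [setLev_self]
  | move => simpa [moved] using hq
  | rob x j' n l hx hn hl hj =>
    by_cases hjj : j = j'
    · subst hjj
      simp [robbed, refresh, hl]
    · simpa [robbed, refresh, hjj] using hq

/-- Together with `Step.undisturbed` this makes the absence of a team permanent and nonemptiness of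
queues monotone. -/
theorem Calm.self {lv : τ → Level m} {i : Thread m} {s s' : State m τ} (h : Calm s)
    (h' : Calm s') (hs : Step lv i s s') :
    (s' i).team = 0 ∧ ∀ j, (s i).queue j ≠ [] → (s' i).queue j ≠ [] := by
  rcases h.step h' hs with ⟨hc, -, rfl⟩ | ⟨hc, -, rfl⟩ | ⟨hc, hcp, hp⟩ | ⟨hc, ht, hcp, hp⟩ |
    ⟨hc, ht, -, hcp, hp⟩
  · rw [put_self]
    exact ⟨((h.inv.loc i).inactive hc).2.1, fun j hj => hj⟩
  · exact ⟨((h.inv.loc i).inactive hc).2.1, fun j hj => hj⟩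
  · exact ⟨(hp.outcome hcp).team_self hcp, (hp.outcome hcp).queue_self⟩
  · have he := headState_of_not h.inv hc (h.run i) ht
    have ho := hp.outcome hcp (by rw [he]; exact hc) (by rw [he]; exact ht)
    refine ⟨ho.team_self hcp, fun j hj => ho.queue_self j ?_⟩
    rwa [headState_queue]
  · refine ⟨(hp.outcome hcp).team_self hcp, fun j hj => (hp.outcome hcp).queue_self j ?_⟩
    rwa [headState_queue]

section Run

variable {lv : τ → Level m} {s : ℕ → State m τ} {σ : ℕ → Thread m}

/-- Only a thread itself can end its task, so one that is running late would still be running at its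
next own step, a step of the excluded kind. -/
theorem IsRun.eventually_run_none (hrun : IsRun lv s σ) (hf : Fair σ)
    (hfin : FiniteComputation s σ) : ∀ᶠ k in atTop, ∀ i, (s k i).run = none := by
  have h1 : ∀ᶠ n in atTop, (s n (σ n)).run = none := by
    rw [← Nat.cofinite_eq_atTop]
    filter_upwards [hfin.eventually_cofinite_notMem] with n hn
    simpa using hn
  obtain ⟨N, hN⟩ := eventually_atTop.1 h1
  refine eventually_atTop.2 ⟨N, fun k hk i => ?_⟩
  by_contra hne
  obtain ⟨n, hn, hσ, hP⟩ := hf.exists_step i (P := fun n => (s n i).run ≠ none) (k := k)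
    (fun n _ hn hσ => by
      rw [((hrun.2 n).undisturbed (hrun.inv n) (Ne.symm hσ)).run]
      exact hn) hne
  exact hP (hσ ▸ hN n (hk.trans hn))

theorem Inv.coord_of_mem_pend {s : State m τ} (h : Inv s) {i c : Thread m}
    (hi : i ∈ (s c).pend) : i ≠ c ∧ (s i).coord = c := by
  obtain ⟨h1, h2⟩ := (h.loc c).pend_team i hi
  exact ⟨h1, h.coord_eq i c ((h.loc c).team_sub (mem_block.2 h2)) h1⟩

/-- While a member is pending its coordinator can only wait, and the member's next step must start
the published task; this would set something running after all execution has ceased. -/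
theorem IsRun.eventually_calm (hrun : IsRun lv s σ) (hf : Fair σ)
    (hfin : FiniteComputation s σ) : ∀ᶠ k in atTop, Calm (s k) := by
  obtain ⟨N, hN⟩ := eventually_atTop.1 (hrun.eventually_run_none hf hfin)
  refine eventually_atTop.2 ⟨N, fun k hk => ⟨hrun.inv k, hN k hk, fun c => ?_⟩⟩
  by_contra hne
  obtain ⟨i, hi⟩ := Finset.nonempty_iff_ne_empty.2 hne
  obtain ⟨n, hn, hσ, hP⟩ := hf.exists_step i (P := fun n => i ∈ (s n c).pend) (k := k)
    (fun n hkn hn hσ => by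
      by_cases hc : σ n = c
      · have hs := hrun.2 n
        rw [hc] at hs
        have hr := hN n (hk.trans hkn) c
        have hne : (s n c).pend ≠ ∅ := Finset.ne_empty_of_mem hn
        have hco : (s n c).coord = c := by
          by_contra h'
          exact hne (((hrun.inv n).loc c).inactive h').2.2
        generalize s (n + 1) = s' at hs ⊢
        cases hs with
        | work => exact hn
        | teamed => exact hn
        | spawn t h1 => exact absurd hr h1
        | finish h1 => exact absurd hr h1
        | start d _ hd hne' => exact absurd hco (hd ▸ hne')
        | revoked d _ hd hne' => exact absurd hco (hd ▸ hne')
        | member d _ hd hne' => exact absurd hco (hd ▸ hne')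
        | wait => exact hn
        | idle _ _ hp => exact absurd hp hne
        | launch _ _ hp => exact absurd hp hne
        | coordinate _ _ hp => exact absurd hp hne
      · exact ((hrun.2 n).undisturbed (hrun.inv n) (Ne.symm hc)).mem_pend i (Ne.symm hσ) hn) hi
  have hs := hrun.2 n
  rw [hσ] at hs
  obtain ⟨hic, hco⟩ := (hrun.inv n).coord_of_mem_pend hP
  have hr := hN n (hk.trans hn) i
  have hr' := hN (n + 1) (hk.trans (hn.trans (Nat.le_succ n))) i
  have hne : (s n i).coord ≠ i := by
    rw [hco]
    exact hic.symm
  generalize s (n + 1) = s' at hs hr'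
  cases hs with
  | work h1 => exact absurd hr h1
  | spawn t h1 => exact absurd hr h1
  | finish h1 => exact absurd hr h1
  | start d _ hd =>
    rw [put_self, hd, hco] at hr'
    exact ((hrun.inv n).loc c).ready (Finset.ne_empty_of_mem hP) hr'
  | revoked d _ hd _ hp =>
    rw [hd, hco] at hp
    exact hp hP
  | teamed d _ hd _ hp =>
    rw [hd, hco] at hp
    exact hp hP
  | member d _ hd _ hp =>
    rw [hd, hco] at hp
    exact hp hP
  | wait _ h1 => exact hne h1
  | idle _ h1 => exact hne h1
  | launch _ h1 => exact hne h1
  | coordinate _ h1 => exact hne h1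

theorem IsRun.eventually_team (hrun : IsRun lv s σ) (hf : Fair σ)
    (hcalm : ∀ᶠ k in atTop, Calm (s k)) : ∀ᶠ k in atTop, ∀ i, (s k i).team = 0 := by
  rw [eventually_all]
  intro i
  obtain ⟨N, hN⟩ := eventually_atTop.1 hcalm
  obtain ⟨n, hn, hσ⟩ := hf i N
  refine eventually_atTop.2 ⟨n + 1, fun k hk => ?_⟩
  have hself : ∀ k, N ≤ k → σ k = i → (s (k + 1) i).team = 0 := fun k hk hσ =>
    ((hN k hk).self (hN (k + 1) (by omega)) (hσ ▸ hrun.2 k)).1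
  induction k, hk using Nat.le_induction with
  | base => exact hself n hn hσ
  | succ k hk ih =>
    by_cases hσ' : σ k = i
    · exact hself k (by omega) hσ'
    · rw [((hrun.2 k).undisturbed (hrun.inv k) (Ne.symm hσ')).team, ih]

/-- In calm states a nonempty queue stays nonempty, so each of the finitely many queues changes its
emptiness at most once. -/
theorem IsRun.eventually_queue (hrun : IsRun lv s σ)
    (hcalm : ∀ᶠ k in atTop, Calm (s k)) : ∃ K, ∀ k, K ≤ k → ∀ i j,
      (s k i).queue j = [] ↔ (s K i).queue j = [] := by
  obtain ⟨N, hN⟩ := eventually_atTop.1 hcalm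
  have hmono : ∀ i j k n, N ≤ k → k ≤ n → (s k i).queue j ≠ [] → (s n i).queue j ≠ [] := by
    intro i j k n hk hkn hne
    induction n, hkn using Nat.le_induction with
    | base => exact hne
    | succ n hn ih =>
      by_cases hσ : σ n = i
      · exact ((hN n (by omega)).self (hN (n + 1) (by omega)) (hσ ▸ hrun.2 n)).2 j ih
      · rwa [Ne, ((hrun.2 n).undisturbed (hrun.inv n) (Ne.symm hσ)).queue]
  have h1 : ∀ i j, ∃ v : Prop, ∀ᶠ k in atTop, ((s k i).queue j = [] ↔ v) := by
    intro i j
    by_cases hex : ∃ k, N ≤ k ∧ (s k i).queue j ≠ []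
    · obtain ⟨k, hk, hne⟩ := hex
      exact ⟨False, eventually_atTop.2 ⟨k, fun n hn =>
        iff_of_false (hmono i j k n hk hn hne) id⟩⟩
    · refine ⟨True, eventually_atTop.2 ⟨N, fun n hn => iff_of_true ?_ trivial⟩⟩
      by_contra hne
      exact hex ⟨n, hn, hne⟩
  choose v hv using h1
  have h2 : ∀ᶠ k in atTop, ∀ i j, ((s k i).queue j = [] ↔ v i j) := by
    rw [eventually_all]
    intro i
    rw [eventually_all]
    exact hv i
  obtain ⟨K, hK⟩ := eventually_atTop.1 h2
  exact ⟨K, fun k hk i j => (hK k hk i j).trans (hK K le_rfl i j).symm⟩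

end Run

/-- Calm states without teams in which the same queues are empty as in `s₀`. -/
structure Quiet (s₀ s : State m τ) : Prop extends Calm s where
  team : ∀ i, (s i).team = 0
  queue : ∀ i j, (s i).queue j = [] ↔ (s₀ i).queue j = []

theorem IsRun.eventually_quiet {lv : τ → Level m} {s : ℕ → State m τ} {σ : ℕ → Thread m}
    (hrun : IsRun lv s σ) (hf : Fair σ) (hfin : FiniteComputation s σ) :
    ∃ s₀, ∀ᶠ k in atTop, Quiet s₀ (s k) := by
  have hcalm := hrun.eventually_calm hf hfin
  obtain ⟨K, hK⟩ := hrun.eventually_queue hcalm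
  refine ⟨s K, ?_⟩
  filter_upwards [hcalm, hrun.eventually_team hf hcalm, eventually_ge_atTop K] with k h1 h2 h3
  exact { h1 with team := h2, queue := hK k h3 }

/-! ### Stabilization of the coordinator references -/

open Classical in
/-- The rank of thread `i` among the possible coordinators: by requirement, then by id; threads
without tasks come last. -/
noncomputable def rank (s₀ : State m τ) (i : Thread m) : ℕ :=
  (if HasTask (s₀ i) then (smallest 0 (s₀ i).queue : ℕ) else m + 1) * 2 ^ m + i

theorem rank_injective (s₀ : State m τ) : Function.Injective (rank s₀) := by
  intro i j h
  unfold rank at h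
  apply Fin.ext
  have := congrArg (· % 2 ^ m) h
  simpa only [Nat.mul_add_mod_self_right, Nat.mod_eq_of_lt i.2, Nat.mod_eq_of_lt j.2] using this

/-- The factor `2 ^ m` exceeds every id and `m + 1` exceeds every level, so the comparison is
lexicographic with taskless threads last. -/
theorem rank_lt_of_smallest_lt {s₀ : State m τ} {i j : Thread m} (hi : HasTask (s₀ i))
    (h : HasTask (s₀ j) → smallest 0 (s₀ i).queue < smallest 0 (s₀ j).queue) :
    rank s₀ i < rank s₀ j := by
  unfold rank
  rw [if_pos hi]
  have key : ∀ b : ℕ, (smallest 0 (s₀ i).queue : ℕ) < b →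
      (smallest 0 (s₀ i).queue : ℕ) * 2 ^ m + (i : ℕ) < b * 2 ^ m + j := by
    intro b hb
    have h1 : ((smallest 0 (s₀ i).queue : ℕ) + 1) * 2 ^ m ≤ b * 2 ^ m :=
      Nat.mul_le_mul_right _ hb
    have := i.2
    rw [Nat.add_mul, one_mul] at h1
    omega
  apply key
  split_ifs with hj
  · exact h hj
  · exact (smallest 0 (s₀ i).queue).2

namespace Quiet

variable {s₀ s s' : State m τ} {i : Thread m}

theorem hasTask (h : Quiet s₀ s) (i : Thread m) : HasTask (s i) ↔ HasTask (s₀ i) :=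
  hasTask_congr (h.queue i)

theorem req_eq (h : Quiet s₀ s) (hc : (s i).coord = i) :
    (s i).req = smallest 0 (s₀ i).queue := by
  rw [(h.inv.loc i).req_eq hc, h.team i, max_eq_right (Fin.zero_le _),
    smallest_congr _ (h.queue i)]

theorem of_req_pos (h : Quiet s₀ s) (hr : 0 < (s i).req) :
    (s i).coord = i ∧ HasTask (s₀ i) := by
  have hc := (h.inv.loc i).coord_of_req hr
  exact ⟨hc, (h.hasTask i).1 ((h.inv.loc i).hasTask_of_lt hc (by rwa [h.team i]))⟩

/-- Both threads have positive requirements, hence coordinate themselves, and their requirements are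
the frozen ones read off from `s₀`. -/
theorem rank_lt_of_beats (h : Quiet s₀ s) {w c : Thread m} (hr : 0 < (s w).req)
    (hb : Beats s w c) : rank s₀ w < rank s₀ c := by
  have hrc : 0 < (s c).req := by
    rcases hb with hb | hb
    · exact hr.trans hb
    · rwa [← hb.1]
  obtain ⟨hw, hwt⟩ := h.of_req_pos hr
  obtain ⟨hc, hct⟩ := h.of_req_pos hrc
  rcases hb with hb | ⟨hb, hlt⟩
  · apply rank_lt_of_smallest_lt hwt
    intro _
    rwa [← h.req_eq hw, ← h.req_eq hc]
  · unfold rank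
    rw [if_pos hwt, if_pos hct, ← h.req_eq hw, ← h.req_eq hc, hb]
    have := Fin.lt_def.1 hlt
    omega

/-- A thread with an active foreign registration has a coordinator with tasks. -/
theorem req_pos_of_mem (h : Quiet s₀ s) {c : Thread m} (hm : i ∈ (s c).acq) (hne : i ≠ c) :
    0 < (s c).req := by
  by_contra hr
  have h0 : (s c).req = 0 := le_antisymm (not_lt.1 hr) (Fin.zero_le _)
  rw [(h.inv.loc c).acq_eq_of_req h0] at hm
  exact hne (Finset.mem_singleton.1 hm)

theorem headState_eq (h : Quiet s₀ s) (hc : (s i).coord = i) : headState i s = s := by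
  unfold headState
  split_ifs
  · rw [(h.inv.loc i).settle_eq_self hc (h.team i), put_eq_self]
  · rfl

theorem step {lv : τ → Level m} (h : Quiet s₀ s) (h' : Quiet s₀ s') (hs : Step lv i s s') :
    ((s i).coord ≠ i ∧ i ∉ (s (s i).coord).acq ∧
      s' = put s i (refresh i { s i with coord := i, lev := 0 })) ∨
    (CanPoll i s ∧
      (((HasTask (s i) ∨ (s i).coord ≠ i) ∧ ((s i).coord = i → ¬ Complete i s) ∧ Poll i s s') ∨
        ((s i).coord = i ∧ ¬ HasTask (s i) ∧ Seek i s s'))) := by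
  rcases h.toCalm.step h'.toCalm hs with h1 | ⟨hc, ht, -⟩ | ⟨hc, hcp, hp⟩ | ⟨hc, ht, hcp, hp⟩ |
    ⟨hc, ht, hn, hcp, hp⟩
  · exact Or.inl h1
  · rw [h.team, sameTeam_zero] at ht
    exact absurd ht hc
  · exact Or.inr ⟨hcp, Or.inl ⟨Or.inr hc, fun h1 => absurd h1 hc, hp⟩⟩
  · rw [h.headState_eq hc] at hcp hp
    exact Or.inr ⟨hcp, Or.inr ⟨hc, ht, hp⟩⟩
  · rw [h.headState_eq hc] at hcp hp hn
    exact Or.inr ⟨hcp, Or.inl ⟨Or.inl ht, fun _ => hn, hp⟩⟩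

/-- Only a registered thread that wins against its coordinator can still steal. -/
theorem rank_lt_of_rob (h : Quiet s₀ s) {x : Thread m} {j : Level m} {n : ℕ} {l : List τ}
    (hl : l ≠ []) (hj : HasTask (s i) ∨ (s i).coord ≠ i → j < (s (s i).coord).req)
    (h' : Quiet s₀ (robbed i x j n l s)) : rank s₀ i < rank s₀ (s i).coord := by
  -- The pattern of empty queues no longer changes, so loot can only go into a queue that was
  -- nonempty before.
  have hq : (s₀ i).queue j ≠ [] := by
    rw [Ne, ← h'.queue i j]
    simp [robbed, refresh, hl]
  have ht : HasTask (s₀ i) := ⟨j, hq⟩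
  have hlt := hj (Or.inl ((h.hasTask i).2 ht))
  obtain ⟨hc, -⟩ := h.of_req_pos (lt_of_le_of_lt (Fin.zero_le _) hlt)
  apply rank_lt_of_smallest_lt ht
  intro _
  rw [← h.req_eq hc]
  exact (smallest_le hq).trans_lt hlt

/-- The possible effects of a step on the registrations, as seen by the acting thread. -/
theorem self_cases {lv : τ → Level m} (h : Quiet s₀ s) (h' : Quiet s₀ s')
    (hs : Step lv i s s') :
    (i ∉ (s (s i).coord).acq ∧ (s i).coord ≠ i ∧ (s' i).coord = i ∧ (s' i).acq ⊆ (s i).acq) ∨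
    (i ∈ (s (s i).coord).acq ∧
      ((∃ ℓ, s' = setLev i ℓ s) ∨
        (∃ w, w ≠ i ∧ rank s₀ w < rank s₀ (s i).coord ∧ s' = moved i w s) ∨
        ((s' i).coord = i ∧ rank s₀ i < rank s₀ (s i).coord ∧ (s' i).acq ⊆ (s i).acq))) := by
  rcases h.step h' hs with ⟨h1, h2, rfl⟩ | ⟨hcp, hp⟩
  · left
    refine ⟨h2, h1, by rw [put_self]; rfl, ?_⟩
    rw [put_self]
    exact LocalInv.refresh_acq_subset (h.inv.loc i).team_sub
  · right
    refine ⟨hcp.mem, ?_⟩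
    have ho : Outcome i s s' := by
      rcases hp with ⟨-, -, hp⟩ | ⟨hc, ht, hp⟩
      · exact hp.outcome hcp
      · exact hp.outcome hcp hc ht
    cases ho with
    | lev ℓ => exact Or.inl ⟨ℓ, rfl⟩
    | move w hwi hwc hr hb ht =>
      refine Or.inr (Or.inl ⟨w, hwi, ?_, rfl⟩)
      by_cases hi : HasTask (s i) ∨ (s i).coord ≠ i
      · exact h.rank_lt_of_beats hr (hb hi)
      · simp only [not_or, not_not] at hi
        rw [hi.2]
        exact rank_lt_of_smallest_lt (h.of_req_pos hr).2
          fun h1 => absurd ((h.hasTask i).2 h1) hi.1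
    | rob x j n l hx hn hl hj =>
      refine Or.inr (Or.inr ⟨by simp [robbed, refresh], h.rank_lt_of_rob hl hj h', ?_⟩)
      simp only [robbed, if_true]
      exact LocalInv.refresh_acq_subset (L :=
        { s i with
          coord := i
          queue := Function.update (s i).queue j (l ++ (s i).queue j)
          lev := 0 }) (h.inv.loc i).team_sub

end Quiet

/-- A measure for the coordinator that thread `i` actually has. -/
noncomputable def potential (s₀ s : State m τ) (i : Thread m) : ℕ :=
  -- The factor `2` makes room for odd values: a revoked registration counts just above being one's
  -- own coordinator, so noticing it is a strict descent, and parity tells whether the registration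
  -- is active.
  if i ∈ (s (s i).coord).acq then 2 * rank s₀ (s i).coord else 2 * rank s₀ i + 1

theorem potential_setLev (s₀ s : State m τ) (i u : Thread m) (ℓ : ℕ) :
    potential s₀ (setLev u ℓ s) i = potential s₀ s i := by
  have h1 : ∀ v, (setLev u ℓ s v).coord = (s v).coord ∧ (setLev u ℓ s v).acq = (s v).acq := by
    intro v
    by_cases hv : v = u
    · subst hv
      rw [setLev_self]
      exact ⟨rfl, rfl⟩
    · rw [setLev_of_ne _ _ hv]
      exact ⟨rfl, rfl⟩
  unfold potential
  rw [(h1 i).1, (h1 _).2]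

theorem Quiet.potential_of_coord {s₀ s : State m τ} {i : Thread m} (h : Quiet s₀ s)
    (hc : (s i).coord = i) : potential s₀ s i = 2 * rank s₀ i := by
  unfold potential
  rw [hc, if_pos (h.inv.loc i).mem_acq]

/-- As long as the threads of smaller rank keep their coordinators, the potential of a thread does
not increase. -/
theorem Quiet.potential_le {lv : τ → Level m} {s₀ s s' : State m τ} {u i : Thread m}
    (h : Quiet s₀ s) (h' : Quiet s₀ s') (hs : Step lv u s s')
    (hst : ∀ c, rank s₀ c < rank s₀ i → (s' c).coord = (s c).coord) :
    potential s₀ s' i ≤ potential s₀ s i := by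
  by_cases hui : u = i
  · subst hui
    rcases h.self_cases h' hs with ⟨h1, -, h3, -⟩ | ⟨h1, ⟨ℓ, rfl⟩ | ⟨w, hwu, hw, rfl⟩ | ⟨h3, h4, -⟩⟩
    · rw [h'.potential_of_coord h3, potential, if_neg h1]
      omega
    · rw [potential_setLev]
    · have : potential s₀ (moved u w s) u = 2 * rank s₀ w := by
        simp [potential, moved, hwu]
      rw [this, potential, if_pos h1]
      omega
    · rw [h'.potential_of_coord h3, potential, if_pos h1]
      omega
  · have hu := hs.undisturbed h.inv (Ne.symm hui)
    by_cases hcu : (s i).coord = u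
    · unfold potential
      rw [hu.coord, hcu]
      have hsub : (s' u).acq ⊆ (s u).acq := by
        rcases h.self_cases h' hs with ⟨-, -, -, h4⟩ | ⟨-, ⟨ℓ, rfl⟩ | ⟨w, -, -, rfl⟩ | ⟨-, -, h4⟩⟩
        · exact h4
        · rw [setLev_self]
        · simpa [moved] using (h.inv.loc u).mem_acq
        · exact h4
      by_cases hm' : i ∈ (s' u).acq
      · rw [if_pos hm', if_pos (hsub hm')]
      rw [if_neg hm']
      by_cases hm : i ∈ (s u).acq
      · rw [if_pos hm]
        -- Thread `u` coordinates itself and drops `i`. If its rank were below that of `i`, it would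
        -- keep its coordinator by `hst`; the drop would need a move elsewhere, or a theft by `u`
        -- with rank below its own.
        have hlt : rank s₀ i < rank s₀ u := by
          by_contra hle
          have hlt : rank s₀ u < rank s₀ i :=
            lt_of_le_of_ne (not_lt.1 hle) fun he => hui (rank_injective s₀ he)
          have hco := hst u hlt
          have huu := (h.of_req_pos (h.req_pos_of_mem hm (Ne.symm hui))).1
          rcases h.self_cases h' hs with ⟨-, h2, -, -⟩ |
            ⟨-, ⟨ℓ, rfl⟩ | ⟨w, hwu, -, rfl⟩ | ⟨-, h4, -⟩⟩
          · exact h2 huu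
          · rw [setLev_self] at hm'
            exact hm' hm
          · simp only [moved, if_true] at hco
            exact hwu (hco.trans huu)
          · rw [huu] at h4
            exact lt_irrefl _ h4
        omega
      · rw [if_neg hm]
    · have hu2 := hs.undisturbed h.inv hcu
      have := hu2.mem_acq i (Ne.symm hui)
      unfold potential
      rw [hu.coord]
      simp only [this, le_refl]

/-- Eventually every thread keeps its coordinator and its registration there. -/
theorem IsRun.eventually_follows {lv : τ → Level m} {s : ℕ → State m τ} {σ : ℕ → Thread m}
    (hrun : IsRun lv s σ) (hf : Fair σ) {s₀ : State m τ}
    (hq : ∀ᶠ k in atTop, Quiet s₀ (s k)) (i : Thread m) :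
    ∃ c, ∀ᶠ k in atTop, Follows (s k) i c := by
  induction hr : rank s₀ i using Nat.strong_induction_on generalizing i with
  | _ r ih =>
    subst hr
    have hst : ∀ᶠ k in atTop, ∀ c, rank s₀ c < rank s₀ i →
        (s (k + 1) c).coord = (s k c).coord := by
      rw [eventually_all]
      intro c
      by_cases hc : rank s₀ c < rank s₀ i
      · obtain ⟨d, hd⟩ := ih _ hc c rfl
        filter_upwards [hd, (tendsto_add_atTop_nat 1).eventually hd] with k h1 h2 _
        exact h2.1.trans h1.1.symm
      · exact Eventually.of_forall fun k h => absurd h hc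
    have hq' := (tendsto_add_atTop_nat 1).eventually hq
    obtain ⟨v, hv⟩ := eventually_const_of_antitone (f := fun k => potential s₀ (s k) i) (by
      filter_upwards [hq, hq', hst] with k h1 h2 h3
      exact h1.potential_le h2 (hrun.2 k) h3)
    -- A constant odd potential is impossible: the next step of `i` either notices the revocation,
    -- giving an even value, or finds an active registration, whose value is even.
    have hact : ∀ᶠ k in atTop, i ∈ (s k (s k i).coord).acq := by
      obtain ⟨N, hN⟩ := eventually_atTop.1 (hq.and (hq'.and hv))
      refine eventually_atTop.2 ⟨N, fun k hk => ?_⟩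
      by_contra hm
      have hvk := (hN k hk).2.2
      rw [potential, if_neg hm] at hvk
      obtain ⟨n, hn, hσ⟩ := hf i k
      obtain ⟨h1, h2, h3⟩ := hN n (hk.trans hn)
      have h4 := (hN (n + 1) (by omega)).2.2
      rcases h1.self_cases h2 (hσ ▸ hrun.2 n) with ⟨-, -, h5, -⟩ | ⟨h5, -⟩
      · rw [h2.potential_of_coord h5] at h4
        omega
      · rw [potential, if_pos h5] at h3
        omega
    obtain ⟨N, hN⟩ := eventually_atTop.1 (hact.and hv)
    refine ⟨(s N i).coord, eventually_atTop.2 ⟨N, fun k hk => ?_⟩⟩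
    obtain ⟨h1, h2⟩ := hN k hk
    obtain ⟨h3, h4⟩ := hN N le_rfl
    rw [potential, if_pos h1] at h2
    rw [potential, if_pos h3] at h4
    have : (s k i).coord = (s N i).coord := rank_injective s₀ (by omega)
    exact ⟨this, this ▸ h1⟩

/-! ### There is no stable state with coordinating threads -/

/-- Quiet states with fixed coordinator references and active registrations. -/
structure Stable (s₀ : State m τ) (C : Thread m → Thread m) (s : State m τ) : Prop
    extends Quiet s₀ s where
  follows : ∀ i, Follows s i (C i)

namespace Stable

variable {s₀ s s' : State m τ} {C : Thread m → Thread m} {i z : Thread m}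

theorem coord (h : Stable s₀ C s) (i : Thread m) : (s i).coord = C i := (h.follows i).1

/-- The coordinator of `i` has tasks, unless `i` is on its own and has no tasks. -/
theorem coordinator (h : Stable s₀ C s) (i : Thread m) :
    (C (C i) = C i ∧ HasTask (s₀ (C i))) ∨ (C i = i ∧ ¬ HasTask (s₀ i)) := by
  by_cases hi : C i = i
  · by_cases ht : HasTask (s₀ i)
    · left
      rw [hi]
      exact ⟨hi, ht⟩
    · exact Or.inr ⟨hi, ht⟩
  · left
    have := h.of_req_pos (h.req_pos_of_mem (h.follows i).2 (Ne.symm hi))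
    rwa [h.coord] at this

theorem lev_of_ne {lv : τ → Level m} {u : Thread m} (h : Stable s₀ C s) (hs : Step lv u s s')
    (hu : u ≠ i) : (s' i).lev = (s i).lev :=
  (hs.undisturbed h.inv (Ne.symm hu)).lev

/-- The thread `z` of smallest rank among the permanent coordinators wins. -/
theorem req_le (h : Stable s₀ C s) (hz : C z = z)
    (hmin : ∀ w, C w = w → HasTask (s₀ w) → rank s₀ z ≤ rank s₀ w) {w : Thread m} (hw : C w = w)
    (hwt : HasTask (s₀ w)) : (s z).req ≤ (s w).req := by
  by_contra hlt
  have hlt' := not_le.1 hlt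
  rw [h.req_eq ((h.coord z).trans hz), h.req_eq ((h.coord w).trans hw)] at hlt'
  exact absurd (hmin w hw hwt) (not_le.2 (rank_lt_of_smallest_lt hwt fun _ => hlt'))

/-- A successful thief becomes its own coordinator; with constant references it was so before, yet
it would need smaller rank than its coordinator. -/
theorem not_robbed {x : Thread m} {j : Level m} {n : ℕ} {l : List τ} (h : Stable s₀ C s)
    (hl : l ≠ []) (hj : HasTask (s i) ∨ (s i).coord ≠ i → j < (s (s i).coord).req)
    (h' : Stable s₀ C (robbed i x j n l s)) : False := by
  have h1 := h.rank_lt_of_rob hl hj h'.toQuiet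
  have h2 := h'.coord i
  simp only [robbed, if_true, refresh] at h2
  rw [h.coord, ← h2] at h1
  exact lt_irrefl _ h1

/-- While thread `i`, which is required by `z`, does not follow `z` although its partner at
level `ℓ` does, it keeps changing its loop variable without ever reaching `ℓ`. -/
theorem scan {lv : τ → Level m} {ℓ : ℕ} (h : Stable s₀ C s) (h' : Stable s₀ C s')
    (hs : Step lv i s s') (hz : C z = z) (hzt : HasTask (s₀ z))
    (hmin : ∀ w, C w = w → HasTask (s₀ w) → rank s₀ z ≤ rank s₀ w)
    (ht : SameTeam z i (smallest 0 (s₀ z).queue)) (hℓ : ℓ < (smallest 0 (s₀ z).queue : ℕ))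
    (hp : C (partner i ℓ) = z) (hi : C i ≠ z) :
    (s i).lev ≠ ℓ ∧
      (((s i).lev < m ∧ (s' i).lev = (s i).lev + 1) ∨ (ℓ < (s i).lev ∧ (s' i).lev = 0)) := by
  have hreq : (s z).req = smallest 0 (s₀ z).queue := h.req_eq ((h.coord z).trans hz)
  rw [← hreq] at ht hℓ
  have hci := h.coord i
  have hci' := h'.coord i
  rcases h.toQuiet.step h'.toQuiet hs with ⟨-, h2, -⟩ | ⟨hcp, ⟨hor, -, hpoll⟩ | ⟨hc, hnt, hseek⟩⟩
  · rw [hci] at h2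
    exact absurd (h.follows i).2 h2
  · have hcc : C (C i) = C i ∧ HasTask (s₀ (C i)) := by
      rcases h.coordinator i with h1 | ⟨h1, h2⟩
      · exact h1
      · rcases hor with h3 | h3
        · exact absurd ((h.hasTask i).1 h3) h2
        · exact absurd (hci.trans h1) h3
    have hle := h.req_le hz hmin hcc.1 hcc.2
    have hle' : ((s z).req : ℕ) ≤ ((s (C i)).req : ℕ) := hle
    have hbeat : (s (C i)).req = (s z).req → z < C i := by
      intro he
      have h1 := lt_of_le_of_ne (hmin _ hcc.1 hcc.2) fun h' => hi (rank_injective s₀ h').symm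
      unfold rank at h1
      rw [if_pos hzt, if_pos hcc.2, ← hreq, ← h.req_eq ((h.coord _).trans hcc.1), he] at h1
      exact Fin.lt_def.2 (by omega)
    cases hpoll with
    -- The coordinator of `i` requires at least as many threads as `z`, so the loop ends only beyond
    -- `ℓ`.
    | done hd =>
      rw [hci] at hd
      refine ⟨by omega, Or.inr ⟨by omega, ?_⟩⟩
      rw [setLev_self]
    | skip c x w a hc ha hx hw hlt hcond =>
      rw [hci] at hc
      subst hc ha hx
      rw [h.coord] at hw
      refine ⟨?_, Or.inl ⟨by omega, ?_⟩⟩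
      · intro hlev
        rw [hlev, hp] at hw
        subst hw
        rcases hcond with h1 | h1 | ⟨h1, h2⟩
        · exact hi h1.symm
        · exact absurd h1 (not_lt.2 hle)
        · exact lt_asymm h2 (hbeat h1.symm)
      · rw [setLev_self]
    | switch c x w a hc ha hx hw hlt hne hcond =>
      exfalso
      rw [hci] at hc
      subst hc ha hx
      rw [h.coord] at hw
      have hlw : (s i).lev < ((s w).req : ℕ) := by
        rcases hcond with h1 | h1
        · rw [h1.1]
          exact hlt
        · exact h1.2
      -- The partner is registered in the block of `w` and the level is below its exponent, so `i`
      -- lies there too; the switch would succeed and change the permanent coordinator.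
      have hwt : SameTeam w i (s w).req := by
        have h1 := (h.inv.loc w).acq_sub (hw ▸ (h.follows (partner i (s i).lev)).2)
        exact (mem_block.1 h1).trans (sameTeam_partner i hlw).symm
      have hwi := hcp.ne_of_req_pos (Fin.lt_def.2 (lt_of_le_of_lt (Nat.zero_le _) hlw))
        (by rwa [hci])
      rw [h.inv.switchTo_eq hwi (by rwa [hci]), if_pos hwt] at hci'
      simp only [moved, if_true] at hci'
      exact hne hci'
    | help c x w a j hc ha hx hw hlt hne hcond haw hj hq =>
      rw [hci] at hc
      subst hc ha hx
      rw [h.coord] at hw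
      -- A partner with tasks has a permanent coordinator with tasks, requiring at least as much as
      -- `z`; stealing occurs only from its requirement upwards, hence beyond `ℓ`.
      have hlev : ℓ < (s i).lev := by
        by_contra hge
        rcases h.coordinator (partner i (s i).lev) with h1 | ⟨-, h1⟩
        · rw [← hw] at h1
          have h2 : ((s z).req : ℕ) ≤ ((s w).req : ℕ) := h.req_le hz hmin h1.1 h1.2
          omega
        · exact h1 ((h.hasTask _).1 ⟨j, hq⟩)
      refine ⟨by omega, Or.inr ⟨hlev, ?_⟩⟩
      have hxi := partner_ne i (ℓ := (s i).lev) (by omega)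
      rcases steal_cases h.inv hxi j (s i).lev with ⟨-, he⟩ | ⟨n, l, hn, hl, he⟩
      · rw [he, setLev_self]
      · rw [he] at h'
        exact (h.not_robbed hl (fun _ => by
          rw [hci]
          exact Fin.lt_def.2 (lt_of_le_of_lt hj hlt)) h').elim
    | nothing c x w a hc ha hx hw hlt hne hcond haw hq =>
      rw [hci] at hc
      subst hc ha hx
      rw [h.coord] at hw
      refine ⟨?_, Or.inl ⟨by omega, ?_⟩⟩
      · intro hlev
        rw [hlev, hp] at hw
        subst hw
        omega
      · rw [setLev_self]
  · have hri : (s i).req = 0 := by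
      rw [h.req_eq hc]
      exact smallest_of_not 0 fun h1 => hnt ((h.hasTask i).2 h1)
    cases hseek with
    | done hd =>
      refine ⟨by omega, Or.inr ⟨by omega, ?_⟩⟩
      rw [setLev_self]
    | join x w a ha hx hw hlt hcond =>
      exfalso
      simp only [register, put_self] at hci'
      rw [← hci, hc] at hci'
      rw [hci', hri] at hcond
      exact Nat.not_lt_zero _ hcond.1
    | rob x w a j ha hx hw hlt hcond hj hq =>
      exfalso
      have hxi : x ≠ i := by
        rw [hx]
        exact partner_ne i hlt
      rcases steal_cases h.inv hxi j a with ⟨h0, -⟩ | ⟨n, l, hn', hl, he⟩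
      · exact hq h0
      · rw [he] at h'
        exact h.not_robbed hl (fun h1 => by simp [hnt, hc] at h1) h'
    | nothing x w a ha hx hw hlt hcond hq =>
      subst ha hx
      rw [h.coord] at hw
      refine ⟨?_, Or.inl ⟨hlt, ?_⟩⟩
      · intro hlev
        rw [hlev, hp] at hw
        subst hw
        exact hcond ⟨by omega, ht⟩
      · rw [setLev_self]

/-- A permanent coordinator that is followed by all threads it requires never is at the head of
its loop and just goes on polling. -/
theorem scan_coordinator {lv : τ → Level m} (h : Stable s₀ C s) (h' : Stable s₀ C s')
    (hs : Step lv z s s') (hz : C z = z) (hzt : HasTask (s₀ z))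
    (hall : ∀ i, SameTeam z i (smallest 0 (s₀ z).queue) → C i = z) :
    (s z).lev ≠ 0 ∧ (((s z).lev < m ∧ (s' z).lev = (s z).lev + 1) ∨ (s' z).lev = 0) := by
  have hcz := (h.coord z).trans hz
  have hreq : (s z).req = smallest 0 (s₀ z).queue := h.req_eq hcz
  rw [← hreq] at hall
  rcases h.toQuiet.step h'.toQuiet hs with ⟨h1, -, -⟩ | ⟨hcp, ⟨hor, hcomp, hpoll⟩ | ⟨-, hnt, -⟩⟩
  · exact absurd hcz h1
  · have hacq : (s z).acq = block z (s z).req := by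
      apply Finset.Subset.antisymm (h.inv.loc z).acq_sub
      intro i hi
      have := (h.follows i).2
      rwa [hall i (mem_block.1 hi)] at this
    -- All required threads are registered, so level `0` would mean a complete team and a launch.
    refine ⟨fun hl => hcomp hcz ⟨hl, by rw [hacq, card_block]⟩, ?_⟩
    have hpart : (s z).lev < ((s z).req : ℕ) → (s (partner z (s z).lev)).coord = z := by
      intro hl
      rw [h.coord]
      exact hall _ (sameTeam_partner z hl)
    cases hpoll with
    | done hd => exact Or.inr (by rw [setLev_self])
    | skip c x w a hc ha hx hw hlt hcond =>
      rw [hcz] at hc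
      subst hc ha
      exact Or.inl ⟨by omega, by rw [setLev_self]⟩
    | switch c x w a hc ha hx hw hlt hne hcond =>
      rw [hcz] at hc
      subst hc ha hx
      exact absurd (hw.trans (hpart hlt)) hne
    | help c x w a j hc ha hx hw hlt hne hcond haw hj hq =>
      rw [hcz] at hc
      subst hc ha hx
      exact absurd (hw.trans (hpart hlt)) hne
    | nothing c x w a hc ha hx hw hlt hne hcond haw hq =>
      rw [hcz] at hc
      subst hc ha hx
      exact absurd (hw.trans (hpart hlt)) hne
  · exact absurd ((h.hasTask z).2 hzt) hnt

end Stable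

/-- In a finite computation no thread can coordinate forever. -/
theorem IsRun.not_coordinating_forever {lv : τ → Level m} {s : ℕ → State m τ} {σ : ℕ → Thread m}
    (hrun : IsRun lv s σ) (hf : Fair σ) (hfin : FiniteComputation s σ) (x : Thread m) :
    ¬ ∀ᶠ k in atTop, Coordinating (s k) x := by
  classical
  intro hx
  obtain ⟨s₀, hq⟩ := hrun.eventually_quiet hf hfin
  choose C hC using hrun.eventually_follows hf hq
  obtain ⟨N, hN⟩ := eventually_atTop.1 (hq.and ((eventually_all.2 hC).and hx))
  have hst : ∀ k, N ≤ k → Stable s₀ C (s k) := fun k hk =>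
    { (hN k hk).1 with follows := (hN k hk).2.1 }
  have hx' : C x = x ∧ HasTask (s₀ x) := by
    obtain ⟨h1, h2, h3⟩ := hN N le_rfl
    exact ⟨(h2 x).1.symm.trans h3.1, (h1.hasTask x).1 h3.2.2.2⟩
  obtain ⟨z, hz, hmin⟩ := Finset.exists_min_image
    (Finset.univ.filter fun z => C z = z ∧ HasTask (s₀ z)) (rank s₀) ⟨x, by simpa using hx'⟩
  simp only [Finset.mem_filter, Finset.mem_univ, true_and] at hz hmin
  have hmin' : ∀ w, C w = w → HasTask (s₀ w) → rank s₀ z ≤ rank s₀ w :=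
    fun w h1 h2 => hmin w ⟨h1, h2⟩
  have hstep : ∀ i ℓ, ℓ < (smallest 0 (s₀ z).queue : ℕ) →
      SameTeam z i (smallest 0 (s₀ z).queue) → C (partner i ℓ) = z → C i = z := by
    intro i ℓ hℓ ht hp
    by_contra hi
    -- The value is the distance to `ℓ`; past `ℓ` the scan must first wrap around to `0`, so those
    -- values are shifted above `ℓ`.
    refine hf.no_descent i (N := N) (f := fun n =>
      if (s n i).lev ≤ ℓ then ℓ - (s n i).lev else ℓ + 1 + (m - (s n i).lev)) ?_ ?_
    · intro n hn hσ
      simp only [(hst n hn).lev_of_ne (hrun.2 n) hσ]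
    · intro n hn hσ
      have hs := hrun.2 n
      rw [hσ] at hs
      obtain ⟨h1, h2⟩ := (hst n hn).scan (hst (n + 1) (by omega)) hs hz.1 hz.2 hmin' ht hℓ hp hi
      have := (smallest 0 (s₀ z).queue).2
      rcases h2 with ⟨h2, h3⟩ | ⟨h2, h3⟩
      · rw [h3]
        split_ifs <;> omega
      · rw [h3]
        split_ifs <;> omega
  have hall : ∀ i, SameTeam z i (smallest 0 (s₀ z).queue) → C i = z := by
    intro i hi
    refine (sameTeam_induction (P := fun i => C i = z ∧
      SameTeam z i (smallest 0 (s₀ z).queue)) _ ?_ ⟨hz.1, SameTeam.refl _ _⟩ hi).1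
    rintro i ℓ hℓ ⟨h1, h2⟩
    have h3 := h2.trans (sameTeam_partner i hℓ)
    exact ⟨hstep _ ℓ hℓ h3 (by rwa [partner_partner]), h3⟩
  -- The value bounds the number of own steps until `z` is back at `ℓ = 0`, where its next step is
  -- contradictory.
  refine hf.no_descent z (N := N) (f := fun n =>
    if (s n z).lev = 0 then 0 else m + 1 - (s n z).lev + 1) ?_ ?_
  · intro n hn hσ
    simp only [(hst n hn).lev_of_ne (hrun.2 n) hσ]
  · intro n hn hσ
    have hs := hrun.2 n
    rw [hσ] at hs
    obtain ⟨h1, h2⟩ := (hst n hn).scan_coordinator (hst (n + 1) (by omega)) hs hz.1 hz.2 hall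
    rcases h2 with ⟨h2, h3⟩ | h3
    · rw [h3]
      split_ifs <;> omega
    · rw [h3]
      split_ifs <;> omega

/-- In a finite computation every conflict is resolved. -/
theorem Conflict.resolved {lv : τ → Level m} {s : ℕ → State m τ} {σ : ℕ → Thread m}
    (hrun : IsRun lv s σ) (hf : Fair σ) (hfin : FiniteComputation s σ) {n : ℕ} {x y : Thread m}
    (h : Conflict (s n) x y) : ∃ n' ≥ n,
      (∀ k, n ≤ k → k ≤ n' → Conflict (s k) x y) ∧ ¬ Conflict (s (n' + 1)) x y ∧
      (Yields (s n') (s (n' + 1)) x y ∨ Yields (s n') (s (n' + 1)) y x) := by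
  classical
  -- A conflict that never ended would keep `x` coordinating forever.
  have hex : ∃ d, ¬ Conflict (s (n + d)) x y := by
    by_contra hall
    push Not at hall
    refine hrun.not_coordinating_forever hf hfin x (eventually_atTop.2 ⟨n, fun k hk => ?_⟩)
    obtain ⟨d, rfl⟩ := Nat.exists_eq_add_of_le hk
    exact (hall d).2.1
  obtain ⟨d, hd⟩ : ∃ d, Nat.find hex = d + 1 := by
    refine Nat.exists_eq_succ_of_ne_zero fun h0 => ?_
    have := Nat.find_spec hex
    rw [h0] at this
    exact this h
  have hbefore : ∀ k, n ≤ k → k ≤ n + d → Conflict (s k) x y := by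
    intro k hk hkd
    obtain ⟨e, rfl⟩ := Nat.exists_eq_add_of_le hk
    exact not_not.1 (Nat.find_min hex (m := e) (by omega))
  have hafter : ¬ Conflict (s (n + d + 1)) x y := by
    have := Nat.find_spec hex
    rwa [hd] at this
  refine ⟨n + d, Nat.le_add_right _ _, hbefore, hafter, ?_⟩
  exact ((hbefore (n + d) (by omega) le_rfl).step (hrun.inv _) (hrun.2 _)).resolve_left hafter

end TeamBuilding

open TeamBuilding in
theorem lemma3 {m : ℕ} {τ : Type*} (lv : τ → Level m) (s : ℕ → State m τ) (σ : ℕ → Thread m)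
    (hrun : IsRun lv s σ) :
    -- tasks stolen during coordination strictly decrease the requirement
    (∀ (n : ℕ) (y : Thread m) (s' : State m τ), Coordinating (s n) y → Step lv y (s n) s' →
      ∀ j : Level m, ((s n y).queue j).length < ((s' y).queue j).length →
        j < (s n y).req ∧ (s' y).req = j ∧ Coordinating s' y) ∧
    (∀ (n : ℕ) (x y : Thread m), Conflict (s n) x y →
      -- exactly one of the two threads wins
      Xor (Beats (s n) x y) (Beats (s n) y x) ∧
      -- a thread on the losing side that is required by the winner switches as soon as it
      -- encounters a thread on the winning side
      (Beats (s n) x y → ∀ (i : Thread m) (s' : State m τ), Step lv i (s n) s' →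
        Follows (s n) i y → FreeToSwitch (s n) i y → SameTeam x i (s n x).req →
        Follows (s n) (partner i (s n i).lev) x → Follows s' i x) ∧
      -- a thread on the winning side that encounters one on the losing side stays
      (Beats (s n) x y → ∀ (i : Thread m) (s' : State m τ), Step lv i (s n) s' →
        Follows (s n) i x → Follows (s n) (partner i (s n i).lev) y → Follows s' i x) ∧
      -- in a finite computation the conflict is eventually resolved
      (Fair σ → FiniteComputation s σ → ∃ n' ≥ n,
        (∀ k, n ≤ k → k ≤ n' → Conflict (s k) x y) ∧ ¬Conflict (s (n' + 1)) x y ∧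
        (Yields (s n') (s (n' + 1)) x y ∨ Yields (s n') (s (n' + 1)) y x))) := by
  refine ⟨fun n y s' hy hs j hj => hy.stolen (hrun.inv n) hs j hj, fun n x y h => ?_⟩
  refine ⟨h.xor_beats, fun hb i s' hs hf hfree ht hp => ?_, fun hb i s' hs hf hp => ?_,
    fun hf hfin => h.resolved hrun hf hfin⟩
  · exact h.switches (hrun.inv n) hb hs hf hfree ht hp
  · exact h.stays (hrun.inv n) hb hs hf hp
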